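/- Let $k$ be a field, let $K_0(\mathcal V_k)$ be the Grothendieck ring of varieties over $k$ (generated by the isomorphism classes of separated $k$-schemes of finite type, with $[X]=[Z]+[X\smallsetminus Z]$ for $Z\subset X$ closed and $[X]\cdot[Y]=[X\times_k Y]$), and let $\mathbb L=[\mathbb A^1_k]$. For a finite graph $\Gamma$ with $n\ge 1$ edges $e_1,\dots,e_n$, let $$\Psi_\Gamma(t)=\sum_{T}\ \prod_{e\notin E(T)} t_e ,$$ where $T$ runs over the spanning forests of $\Gamma$ (the maximal acyclic subgraphs; these are the spanning trees if $\Gamma$ is connected), and let $X_\Gamma=\{\Psi_\Gamma=0\}\subset\mathbb P^{n-1}_k$ be the projective graph hypersurface. A graph is a chain of polygons if it is obtained as follows: start with a polygon with at least $3$ sides and, finitely many times (possibly never), attach a new polygon with at least $3$ sides along one free side of the polygon attached last. Here every side of the first polygon is free; for a later polygon the free sides are all its sides except the one along which it was attached; and a new polygon shares with the graph constructed so far only the side along which it is attached and the two endpoints of that side. For every graph $\Gamma$ that is a chain of polygons, the class $[X_\Gamma]$ lies in the Tate subring $\mathbb Z[\mathbb L]\subset K_0(\mathcal V_k)$, i.e.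 in the subring generated by $\mathbb L$. -/

import Mathlib

universe u

open CategoryTheory AlgebraicGeometry MonoidalCategory

noncomputable section

/-! ### The Grothendieck ring of varieties -/

namespace GrothendieckRing

attribute [local instance] CategoryTheory.Over.cartesianMonoidalCategory
attribute [local instance] CategoryTheory.Over.braidedCategory

variable (k : Type u) [Field k]

/-- A variety over `k` is a separated scheme of finite type over `k`. (Asking in addition that
varieties be reduced would give the same Grothendieck ring, since a scheme and its reduction have
the same class.) -/
def IsVariety : ObjectProperty (Over (Spec (CommRingCat.of k))) := fun X =>
  LocallyOfFiniteType X.hom ∧ QuasiCompact X.hom ∧ IsSeparated X.hom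

/-- Varieties over `k` are closed under fibre products over `k` and contain `Spec k`. -/
instance : (IsVariety k).IsMonoidal where
  prop_unit := by
    exact ⟨inferInstanceAs (LocallyOfFiniteType (𝟙 (Spec (CommRingCat.of k)))),
      inferInstanceAs (QuasiCompact (𝟙 (Spec (CommRingCat.of k)))),
      inferInstanceAs (IsSeparated (𝟙 (Spec (CommRingCat.of k))))⟩
  prop_tensor X Y hX hY := by
    obtain ⟨_, _, _⟩ := hX
    obtain ⟨_, _, _⟩ := hY
    refine ⟨?_, ?_, ?_⟩ <;> rw [Over.tensorObj_hom] <;> infer_instance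

/-- The category of varieties over `k`, with the monoidal structure given by the
fibre product over `Spec k`. -/
abbrev Var : Type (u + 1) := (IsVariety k).FullSubcategory

/-- The free commutative ring on the commutative monoid of isomorphism classes of varieties over
`k`: additively it is the free abelian group on the isomorphism classes, and its product is induced
by the fibre product over `k`. -/
abbrev FreeRing : Type (u + 1) := MonoidAlgebra ℤ (Skeleton (Var k))

variable {k} in
/-- The isomorphism class of a variety, as a generator of the free ring. -/
def generator (X : Var k) : FreeRing k := MonoidAlgebra.of ℤ (Skeleton (Var k)) (toSkeleton X)

/-- The scissor relations `[X] - [Z] - [U]`, for `Z` a closed subscheme of the variety `X` and `U`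
its open complement. -/
def scissorRelations : Set (FreeRing k) :=
  {a | ∃ (X Z U : Var k) (i : Z ⟶ X) (j : U ⟶ X),
    IsClosedImmersion i.hom.left ∧ IsOpenImmersion j.hom.left ∧
    Set.range j.hom.left = (Set.range i.hom.left)ᶜ ∧
    a = generator X - generator Z - generator U}

/-- The Grothendieck ring `K₀(Var_k)` of varieties over `k`. (The subgroup spanned by the scissor
relations is already an ideal, because these relations are stable under products with a variety.) -/
abbrev K0 : Type (u + 1) := FreeRing k ⧸ Ideal.span (scissorRelations k)

variable {k} in
/-- The class `[X]` of a variety in the Grothendieck ring. -/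
def cls (X : Var k) : K0 k := Ideal.Quotient.mk _ (generator X)

/-- The affine line over `k`, as a variety. -/
def affineLine : Var k where
  obj := Over.mk (Spec.map (CommRingCat.ofHom (algebraMap k (Polynomial k))))
  property := by
    let φ := CommRingCat.ofHom (algebraMap k (Polynomial k))
    refine ⟨?_, inferInstanceAs (QuasiCompact (Spec.map φ)),
      inferInstanceAs (IsSeparated (Spec.map φ))⟩
    change LocallyOfFiniteType (Spec.map φ)
    rw [HasRingHomProperty.Spec_iff (P := @LocallyOfFiniteType)]
    exact RingHom.finiteType_algebraMap.mpr inferInstance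

/-- The Lefschetz class `𝕃 = [𝔸¹]`. -/
def lefschetz : K0 k := cls (affineLine k)

/-- The Tate subring `ℤ[𝕃]` of `K₀(Var_k)`, that is the subring generated by `𝕃`. -/
def tateSubring : Subring (K0 k) := Subring.closure {lefschetz k}

end GrothendieckRing

/-! ### Projective hypersurfaces -/

namespace ProjectiveHypersurface

attribute [local instance] MvPolynomial.gradedAlgebra

variable (σ : Type u) (k : Type u) [Field k]

/-- Projective space over `k` with homogeneous coordinates indexed by `σ`. -/
def projectiveSpace : Scheme.{u} := Proj (MvPolynomial.homogeneousSubmodule σ k)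

/-- The structure morphism of projective space. -/
def structureMap : projectiveSpace σ k ⟶ Spec (CommRingCat.of k) :=
  Proj.toSpecZero (MvPolynomial.homogeneousSubmodule σ k) ≫
    Spec.map (CommRingCat.ofHom (algebraMap k (MvPolynomial.homogeneousSubmodule σ k 0)))

variable {σ k}

/-- The closed set of the points of projective space at which `f` vanishes (a homogeneous prime
ideal `x` is such a point when `f ∈ x`). -/
def zeroLocus (f : MvPolynomial σ k) : TopologicalSpace.Closeds (projectiveSpace σ k) where
  carrier := ProjectiveSpectrum.zeroLocus (MvPolynomial.homogeneousSubmodule σ k) {f}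
  isClosed' := ProjectiveSpectrum.isClosed_zeroLocus _ _

/-- The hypersurface `{f = 0}` in projective space, with its reduced scheme structure. -/
def hypersurface (f : MvPolynomial σ k) : Scheme.{u} :=
  (Scheme.IdealSheafData.vanishingIdeal (zeroLocus f)).subscheme

/-- The inclusion of the hypersurface `{f = 0}` in projective space. -/
def hypersurfaceι (f : MvPolynomial σ k) : hypersurface f ⟶ projectiveSpace σ k :=
  (Scheme.IdealSheafData.vanishingIdeal (zeroLocus f)).subschemeι

instance (f : MvPolynomial σ k) : IsClosedImmersion (hypersurfaceι f) := by
  exact inferInstanceAs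
    (IsClosedImmersion (Scheme.IdealSheafData.vanishingIdeal (zeroLocus f)).subschemeι)

theorem isVariety_projectiveSpace [Finite σ] :
    GrothendieckRing.IsVariety k (Over.mk (structureMap σ k)) := by
  let 𝒜 := MvPolynomial.homogeneousSubmodule σ k
  have hsurj : Function.Surjective (algebraMap k (𝒜 0)) := by
    rintro ⟨p, hp⟩
    refine ⟨MvPolynomial.coeff 0 p, Subtype.ext ?_⟩
    exact (MvPolynomial.totalDegree_eq_zero_iff_eq_C.mp
      (Nat.le_zero.mp (MvPolynomial.IsHomogeneous.totalDegree_le hp))).symm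
  have : IsScalarTower k (𝒜 0) (MvPolynomial σ k) :=
    IsScalarTower.of_algebraMap_eq (R := k) (S := 𝒜 0) (A := MvPolynomial σ k) fun _ => rfl
  have : Algebra.FiniteType (𝒜 0) (MvPolynomial σ k) := .of_restrictScalars_finiteType k _ _
  let φ := CommRingCat.ofHom (algebraMap k (𝒜 0))
  have : IsClosedImmersion (Spec.map φ) := IsClosedImmersion.spec_of_surjective _ hsurj
  exact ⟨inferInstanceAs (LocallyOfFiniteType (Proj.toSpecZero 𝒜 ≫ Spec.map φ)),
    inferInstanceAs (QuasiCompact (Proj.toSpecZero 𝒜 ≫ Spec.map φ)),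
    inferInstanceAs (IsSeparated (Proj.toSpecZero 𝒜 ≫ Spec.map φ))⟩

/-- The hypersurface `{f = 0}` in projective space, as a variety over `k`. -/
def hypersurfaceVar [Finite σ] (f : MvPolynomial σ k) : GrothendieckRing.Var k where
  obj := Over.mk (hypersurfaceι f ≫ structureMap σ k)
  property := by
    obtain ⟨h₁, h₂, h₃⟩ := isVariety_projectiveSpace (σ := σ) (k := k)
    simp only [Over.mk_hom] at h₁ h₂ h₃
    refine ⟨?_, ?_, ?_⟩ <;> simp only [Over.mk_hom] <;> infer_instance

end ProjectiveHypersurface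

/-! ### Graph hypersurfaces and chains of polygons -/

namespace SimpleGraph

open Classical in
/-- The Kirchhoff–Symanzik polynomial `Ψ_Γ = ∑_T ∏_{e ∉ T} t_e` of a finite graph, with one variable
for each edge; `T` runs over the spanning forests of `Γ`, i.e. the maximal acyclic subgraphs (the
spanning trees, if `Γ` is connected). -/
def kirchhoffPolynomial (k : Type u) [Field k] {V : Type u} [Fintype V] (Γ : SimpleGraph V) :
    MvPolynomial Γ.edgeSet k :=
  ∑ T : SimpleGraph V with Maximal (fun H => H ≤ Γ ∧ H.IsAcyclic) T,
    ∏ e ∈ Finset.univ.filter (fun e : Γ.edgeSet => (e : Sym2 V) ∉ T.edgeSet), MvPolynomial.X e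

/-- The graph hypersurface `X_Γ = {Ψ_Γ = 0} ⊆ ℙ^{n-1}` over `k`, `n` the number of edges of `Γ`. -/
def graphHypersurface (k : Type u) [Field k] {V : Type u} [Fintype V] (Γ : SimpleGraph V) :
    GrothendieckRing.Var k :=
  ProjectiveHypersurface.hypersurfaceVar (Γ.kirchhoffPolynomial k)

variable {V : Type*}

/-- The sides of the `r`-gon with cyclically ordered vertices `p 0, p 1, …, p (r - 1)`. -/
def polygonSides {r : ℕ} (p : ZMod r → V) : Set (Sym2 V) := Set.range fun i => s(p i, p (i + 1))

/-- `PolygonChain E F`: the set `E` of edges is obtained as a chain of polygons, and `F` is the set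
of the free sides of the polygon attached last. One starts from a polygon with at least three
sides, and at each step attaches a new polygon with at least three sides to one free side of the
last polygon; the new polygon has only this side and its two endpoints in common with the graph
built so far. -/
inductive PolygonChain : Set (Sym2 V) → Set (Sym2 V) → Prop
  | polygon {r : ℕ} (hr : 3 ≤ r) (p : ZMod r → V) (hp : Function.Injective p) :
      PolygonChain (polygonSides p) (polygonSides p)
  | attach {E F : Set (Sym2 V)} (hE : PolygonChain E F) {r : ℕ} (hr : 3 ≤ r) (p : ZMod r → V)
      (hp : Function.Injective p) (hside : s(p 0, p 1) ∈ F)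
      (hnew : ∀ i, i ≠ 0 → i ≠ 1 → ∀ e ∈ E, p i ∉ e) :
      PolygonChain (E ∪ polygonSides p) (polygonSides p \ {s(p 0, p 1)})

/-- The graph `Γ` is a chain of polygons. -/
def IsPolygonChain (Γ : SimpleGraph V) : Prop :=
  (∃ F, PolygonChain Γ.edgeSet F) ∧ ∀ v, ∃ w, Γ.Adj v w

end SimpleGraph

end

/-! Attaching a path changes the graph polynomial in a controlled way. Let a path with edge set `N`
be attached to a graph `E` at the two ends of an edge `e`. A maximal forest of the new graph either
omits exactly one `f ∈ N` and restricts to a maximal forest of `E`, or contains `N` and arises from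
a maximal forest of `E` through `e` by deleting `e`. Hence the new polynomial is `A' = s A + B`,
where `s = ∑ f ∈ N, t_f`, `A` is the old polynomial, and `B` is `t_e` times the part of `A` coming
from forests through `e` (`IsAttached.basisSum_eq`). The forests through a given `u ∈ N` contribute
`(s - t_u) A + B` (`IsAttached.basisSumThrough_eq`). Neither `A` nor `B` involves the variables of
`N`.

So `A'` is linear in each `t_f`, `f ∈ N`, with coefficient `A`. Solving for `t_f` where `A ≠ 0`
expresses `[A' = 0]` through `[A = 0]` and `[A = B = 0]` (`zeroClass_linear`,
`zeroClass_attach_mem`). To go on along a side `u ∈ N`, one also needs `[A' = B' = 0]` with `B' =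
t_u ((s - t_u) A + B) = t_u A' - t_u² A`. As a set this locus is `{A' = t_u A = 0}`.
Inclusion-exclusion reduces it to `{t_u = 0, (s - t_u) A + B = 0}`, `{A = B = 0}` and `{t_u = A = B
= 0}` (`zeroClass_attach_pair_mem`). The first of these is linear in a further variable of `N`,
which exists because the polygon has at least three sides. Thus the two statements, for `A` and for
the pair `A, B`, propagate together along the chain (`IsTame`).

The projective hypersurface is reduced to affine pieces by means of the first polygon `P`. The
polynomial lies in the ideal generated by the `t_f`, `f ∈ P`, so the hypersurface contains the
linear subspace where these vanish. The rest is cut into strata `t_i = 1` and `t_j = 0` for `j ∈ Z`,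
with `i ∈ P` and `Z ⊆ P` (`cls_hypersurfaceVar_mem`). This normalization never touches variables
attached later, so the induction runs inside the strata; it starts from the linear form `∑ f ∈ P,
t_f`. -/

noncomputable section

/-! ### Classes of closed subsets and scissor relations. -/

namespace GrothendieckRing

attribute [local instance] CategoryTheory.Over.cartesianMonoidalCategory
attribute [local instance] CategoryTheory.Over.braidedCategory

variable {k : Type u} [Field k]

local notation "Sk" => Spec (CommRingCat.of k)

open Classical in
/-- The class in `K₀(Var_k)` of the source of a structure morphism `f`, and `0` if this is not a
variety. -/
def classOf {X : Scheme.{u}} (f : X ⟶ Spec (CommRingCat.of k)) : K0 k :=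
  if h : IsVariety k (Over.mk f) then cls ⟨Over.mk f, h⟩ else 0

theorem classOf_hom (X : Var k) : classOf X.obj.hom = cls X := by
  have h : IsVariety k (Over.mk X.obj.hom) := X.property
  rw [classOf, dif_pos h]
  rfl

theorem cls_congr {X Y : Var k} (e : X ≅ Y) : cls X = cls Y := by
  have : toSkeleton X = toSkeleton Y := Quotient.sound ⟨e⟩
  simp only [cls, generator, this]

theorem IsVariety.comp {X Y : Scheme.{u}} {f : X ⟶ Sk} (hf : IsVariety k (Over.mk f))
    (i : Y ⟶ X) [LocallyOfFiniteType i] [QuasiCompact i] [IsSeparated i] :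
    IsVariety k (Over.mk (i ≫ f)) := by
  obtain ⟨h₁, h₂, h₃⟩ := hf
  simp only [Over.mk_hom] at h₁ h₂ h₃
  refine ⟨?_, ?_, ?_⟩ <;> simp only [Over.mk_hom] <;> infer_instance

theorem IsVariety.isLocallyNoetherian {X : Scheme.{u}} {f : X ⟶ Sk}
    (hf : IsVariety k (Over.mk f)) : IsLocallyNoetherian X := by
  obtain ⟨h₁, -, -⟩ := hf
  simp only [Over.mk_hom] at h₁
  exact LocallyOfFiniteType.isLocallyNoetherian f

theorem classOf_eq_add {X Z U : Scheme.{u}} {f : X ⟶ Sk} (hf : IsVariety k (Over.mk f))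
    (i : Z ⟶ X) (j : U ⟶ X) [IsClosedImmersion i] [IsOpenImmersion j]
    (h : Set.range j = (Set.range i)ᶜ) :
    classOf f = classOf (i ≫ f) + classOf (j ≫ f) := by
  -- Open immersions into a locally Noetherian scheme are quasi-compact, so the open piece is again
  -- a variety.
  have := hf.isLocallyNoetherian
  have hi := hf.comp i
  have hj := hf.comp j
  rw [classOf, dif_pos hf, classOf, dif_pos hi, classOf, dif_pos hj]
  have key : generator ⟨Over.mk f, hf⟩ - generator ⟨Over.mk (i ≫ f), hi⟩
      - generator ⟨Over.mk (j ≫ f), hj⟩ ∈ Ideal.span (scissorRelations k) :=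
    Ideal.subset_span ⟨⟨Over.mk f, hf⟩, ⟨Over.mk (i ≫ f), hi⟩, ⟨Over.mk (j ≫ f), hj⟩,
      ObjectProperty.homMk (Over.homMk i), ObjectProperty.homMk (Over.homMk j),
      ‹_›, ‹_›, h, rfl⟩
  rw [sub_sub, ← Ideal.Quotient.mk_eq_mk_iff_sub_mem, map_add] at key
  exact key

theorem classOf_of_isEmpty {X : Scheme.{u}} [IsEmpty X] (f : X ⟶ Sk) : classOf f = 0 := by
  by_cases hf : IsVariety k (Over.mk f)
  · have := classOf_eq_add hf (𝟙 X) (𝟙 X) (Set.ext fun x => isEmptyElim x)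
    simpa using this
  · rw [classOf, dif_neg hf]

/-- The class of a closed subset `C` of the source of a structure morphism `f`. -/
def closedClass {X : Scheme.{u}} (f : X ⟶ Spec (CommRingCat.of k))
    (C : TopologicalSpace.Closeds X) : K0 k :=
  classOf ((Scheme.IdealSheafData.vanishingIdeal C).subschemeι ≫ f)

theorem range_subschemeι_vanishingIdeal {X : Scheme.{u}} (C : TopologicalSpace.Closeds X) :
    Set.range (Scheme.IdealSheafData.vanishingIdeal C).subschemeι = C := by
  rw [Scheme.IdealSheafData.range_subschemeι]
  rfl

/-- Two closed subschemes with the same support have the same open complement, which cancels in the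
two scissor relations. Non-reduced structures are therefore invisible, and only closed sets matter
from here on. -/
theorem classOf_eq_closedClass {X Z : Scheme.{u}} {f : X ⟶ Sk} (hf : IsVariety k (Over.mk f))
    (i : Z ⟶ X) [IsClosedImmersion i] {C : TopologicalSpace.Closeds X} (h : Set.range i = C) :
    classOf (i ≫ f) = closedClass f C := by
  let U : X.Opens := C.compl
  have h₁ := classOf_eq_add hf i U.ι (by rw [h, Scheme.Opens.range_ι]; rfl)
  have h₂ := classOf_eq_add hf (Scheme.IdealSheafData.vanishingIdeal C).subschemeι U.ι
    (by rw [range_subschemeι_vanishingIdeal, Scheme.Opens.range_ι]; rfl)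
  exact add_right_cancel (h₁.symm.trans h₂)

theorem classOf_eq_closedClass_top {X : Scheme.{u}} {f : X ⟶ Sk}
    (hf : IsVariety k (Over.mk f)) : classOf f = closedClass f ⊤ := by
  simpa using classOf_eq_closedClass hf (𝟙 X) (C := ⊤) (by ext; simp)

theorem closedClass_bot {X : Scheme.{u}} {f : X ⟶ Sk} : closedClass f ⊥ = 0 := by
  have : IsEmpty (Scheme.IdealSheafData.vanishingIdeal (⊥ : TopologicalSpace.Closeds X)).subscheme := by
    refine ⟨fun x => ?_⟩
    have := Set.mem_range_self (f := (Scheme.IdealSheafData.vanishingIdeal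
      (⊥ : TopologicalSpace.Closeds X)).subschemeι) x
    rw [range_subschemeι_vanishingIdeal] at this
    exact this
  exact classOf_of_isEmpty _

theorem closedClass_of_isClosedImmersion {X Y : Scheme.{u}} {f : X ⟶ Sk}
    (hf : IsVariety k (Over.mk f)) (i : Y ⟶ X) [IsClosedImmersion i]
    {C : TopologicalSpace.Closeds X} {D : TopologicalSpace.Closeds Y}
    (h : i '' (D : Set Y) = C) : closedClass (i ≫ f) D = closedClass f C := by
  rw [closedClass, ← Category.assoc]
  refine classOf_eq_closedClass hf _ ?_
  rw [← h, ← range_subschemeι_vanishingIdeal D, ← Set.range_comp]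
  simp

/-- Cut the reduced subscheme on `C` along its fibre product with `U`. That fibre product is also a
closed subscheme of `U` with support `D`, and its complement has support `C'`. -/
theorem closedClass_eq_add {X U : Scheme.{u}} {f : X ⟶ Sk} (hf : IsVariety k (Over.mk f))
    (j : U ⟶ X) [IsOpenImmersion j] {C C' : TopologicalSpace.Closeds X}
    {D : TopologicalSpace.Closeds U} (hC' : (C' : Set X) = (C : Set X) \ Set.range j)
    (hD : (D : Set U) = j ⁻¹' C) :
    closedClass f C = closedClass f C' + closedClass (j ≫ f) D := by
  have := hf.isLocallyNoetherian
  let ι := (Scheme.IdealSheafData.vanishingIdeal C).subschemeι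
  have hι : Set.range ι = C := range_subschemeι_vanishingIdeal C
  let B : TopologicalSpace.Closeds (Scheme.IdealSheafData.vanishingIdeal C).subscheme :=
    ⟨ι ⁻¹' (C' : Set X), C'.isClosed.preimage ι.continuous⟩
  let β := (Scheme.IdealSheafData.vanishingIdeal B).subschemeι
  have hβ : Set.range β = B := range_subschemeι_vanishingIdeal B
  have hfst : Set.range (Limits.pullback.fst ι j) = ι ⁻¹' Set.range j :=
    Scheme.Pullback.range_fst ι j
  have hsnd : Set.range (Limits.pullback.snd ι j) = j ⁻¹' Set.range ι :=
    Scheme.Pullback.range_snd ι j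
  have h₁ := classOf_eq_add (hf.comp ι) β (Limits.pullback.fst ι j) (by
    rw [hfst, hβ]
    ext x
    have hx : ι x ∈ (C : Set X) := hι ▸ Set.mem_range_self x
    change ι x ∈ Set.range j ↔ ¬ (ι x ∈ (C' : Set X))
    rw [hC']
    simp only [Set.mem_sdiff, hx, true_and, not_not])
  have h₂ : classOf (β ≫ ι ≫ f) = closedClass f C' := by
    rw [← Category.assoc]
    refine classOf_eq_closedClass hf _ ?_
    rw [Scheme.Hom.comp_base, TopCat.coe_comp, Set.range_comp, hβ]
    change ι '' (ι ⁻¹' (C' : Set X)) = _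
    rw [Set.image_preimage_eq_inter_range, hι, hC']
    exact Set.inter_eq_left.mpr Set.sdiff_subset
  have h₃ : classOf (Limits.pullback.fst ι j ≫ ι ≫ f) = closedClass (j ≫ f) D := by
    rw [← Category.assoc, Limits.pullback.condition, Category.assoc]
    exact classOf_eq_closedClass (hf.comp j) _ (by rw [hsnd, hι, hD])
  rw [closedClass, h₁, h₂, h₃]

end GrothendieckRing

/-! ### Zero sets in affine schemes. -/

namespace GrothendieckRing

attribute [local instance] CategoryTheory.Over.cartesianMonoidalCategory
attribute [local instance] CategoryTheory.Over.braidedCategory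

section ZeroClass

variable (k : Type u) [Field k]

/-- The structure morphism of the spectrum of a `k`-algebra. -/
abbrev specMap (R : Type u) [CommRing R] [Algebra k R] :
    Spec (CommRingCat.of R) ⟶ Spec (CommRingCat.of k) :=
  Spec.map (CommRingCat.ofHom (algebraMap k R))

/-- The closed set `{S = 0}` in the spectrum of a ring. -/
def specZeroLocus {R : Type u} [CommRing R] (S : Set R) :
    TopologicalSpace.Closeds (Spec (CommRingCat.of R)) :=
  ⟨PrimeSpectrum.zeroLocus S, PrimeSpectrum.isClosed_zeroLocus S⟩

/-- The class in `K₀(Var_k)` of the closed set `{S = 0}` in the spectrum of a `k`-algebra. -/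
def zeroClass {R : Type u} [CommRing R] [Algebra k R] (S : Set R) : K0 k :=
  closedClass (specMap k R) (specZeroLocus S)

theorem isVariety_spec (R : Type u) [CommRing R] [Algebra k R] [Algebra.FiniteType k R] :
    IsVariety k (Over.mk (specMap k R)) := by
  refine ⟨?_, inferInstanceAs (QuasiCompact (specMap k R)),
    inferInstanceAs (IsSeparated (specMap k R))⟩
  change LocallyOfFiniteType (specMap k R)
  rw [HasRingHomProperty.Spec_iff (P := @LocallyOfFiniteType)]
  exact RingHom.finiteType_algebraMap.mpr inferInstance

variable {k} {R : Type u} [CommRing R] [Algebra k R]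

theorem zeroClass_congr {S T : Set R}
    (h : PrimeSpectrum.zeroLocus S = PrimeSpectrum.zeroLocus T) :
    zeroClass k S = zeroClass k T := by
  have : specZeroLocus S = specZeroLocus T := TopologicalSpace.Closeds.ext h
  rw [zeroClass, zeroClass, this]

theorem zeroClass_congr_span {S T : Set R} (h : Ideal.span S = Ideal.span T) :
    zeroClass k S = zeroClass k T :=
  zeroClass_congr (by rw [← PrimeSpectrum.zeroLocus_span S, h, PrimeSpectrum.zeroLocus_span])

theorem zeroClass_eq_zero {S : Set R} (h : (1 : R) ∈ Ideal.span S) : zeroClass k S = 0 := by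
  have : specZeroLocus S = ⊥ := TopologicalSpace.Closeds.ext (by
    change PrimeSpectrum.zeroLocus S = ∅
    rw [← PrimeSpectrum.zeroLocus_span,
      PrimeSpectrum.zeroLocus_empty_iff_eq_top.mpr ((Ideal.eq_top_iff_one _).mpr h)])
  rw [zeroClass, this, closedClass_bot]

theorem classOf_specMap [Algebra.FiniteType k R] :
    classOf (specMap k R) = zeroClass k (∅ : Set R) := by
  rw [classOf_eq_closedClass_top (isVariety_spec k R)]
  congr 1
  exact TopologicalSpace.Closeds.ext PrimeSpectrum.zeroLocus_empty.symm

theorem specMap_comp {T : Type u} [CommRing T] [Algebra k T] (φ : R →ₐ[k] T) :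
    Spec.map (CommRingCat.ofHom φ.toRingHom) ≫ specMap k R = specMap k T := by
  rw [← Spec.map_comp, ← CommRingCat.ofHom_comp]
  congr 2
  exact φ.comp_algebraMap

/-- The kernel condition puts `{S = 0}` inside the closed subscheme `Spec T`, and the class of a
closed set does not depend on the ambient variety. -/
theorem zeroClass_of_surjective [Algebra.FiniteType k R] {T : Type u} [CommRing T] [Algebra k T]
    (φ : R →ₐ[k] T) (hφ : Function.Surjective φ) {S : Set R}
    (h : RingHom.ker φ ≤ Ideal.span S) : zeroClass k (φ '' S) = zeroClass k S := by
  have : IsClosedImmersion (Spec.map (CommRingCat.ofHom φ.toRingHom)) :=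
    IsClosedImmersion.spec_of_surjective _ hφ
  have key := closedClass_of_isClosedImmersion (isVariety_spec k R)
    (Spec.map (CommRingCat.ofHom φ.toRingHom)) (C := specZeroLocus S)
    (D := specZeroLocus (φ '' S)) (by
      change PrimeSpectrum.comap φ.toRingHom '' PrimeSpectrum.zeroLocus (φ '' S)
        = PrimeSpectrum.zeroLocus S
      rw [← PrimeSpectrum.zeroLocus_span (φ '' S),
        image_comap_zeroLocus_eq_zeroLocus_comap _ _ hφ,
        ← PrimeSpectrum.zeroLocus_span S]
      congr 2
      change Ideal.comap φ.toRingHom (Ideal.span (φ.toRingHom '' S)) = _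
      rw [← Ideal.map_span, Ideal.comap_map_of_surjective φ.toRingHom hφ]
      exact sup_eq_left.mpr h)
  rw [specMap_comp] at key
  exact key

theorem zeroClass_of_algEquiv [Algebra.FiniteType k R] {T : Type u} [CommRing T] [Algebra k T]
    (φ : R ≃ₐ[k] T) (S : Set R) : zeroClass k (φ '' S) = zeroClass k S :=
  zeroClass_of_surjective φ.toAlgHom φ.surjective (by
    intro x hx
    have : φ x = 0 := hx
    rw [(map_eq_zero_iff φ φ.injective).mp this]
    exact zero_mem _)

theorem zeroClass_quotient [Algebra.FiniteType k R] (S T : Set R) :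
    zeroClass k (Ideal.Quotient.mkₐ k (Ideal.span S) '' T) = zeroClass k (S ∪ T) := by
  rw [← zeroClass_of_surjective (Ideal.Quotient.mkₐ k (Ideal.span S))
    (Ideal.Quotient.mkₐ_surjective k _) (S := S ∪ T)]
  · refine zeroClass_congr_span ?_
    rw [Set.image_union, Ideal.span_union, eq_comm, sup_eq_right, Ideal.span_le]
    rintro _ ⟨s, hs, rfl⟩
    have : Ideal.Quotient.mkₐ k (Ideal.span S) s = 0 :=
      Ideal.Quotient.eq_zero_iff_mem.mpr (Ideal.subset_span hs)
    rw [this]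
    exact zero_mem _
  · intro x hx
    exact Ideal.span_mono Set.subset_union_left (Ideal.Quotient.eq_zero_iff_mem.mp hx)

theorem zeroClass_localization [Algebra.FiniteType k R] (f : R) (T : Type u) [CommRing T]
    [Algebra k T] [Algebra R T] [IsScalarTower k R T] [IsLocalization.Away f T] (S : Set R) :
    zeroClass k S = zeroClass k (insert f S) + zeroClass k (algebraMap R T '' S) := by
  have := IsOpenImmersion.of_isLocalization (S := T) f
  have hr : Set.range (Spec.map (CommRingCat.ofHom (algebraMap R T)))
      = (PrimeSpectrum.basicOpen f : Set (PrimeSpectrum R)) :=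
    PrimeSpectrum.localization_away_comap_range T f
  have key := closedClass_eq_add (isVariety_spec k R)
    (Spec.map (CommRingCat.ofHom (algebraMap R T))) (C := specZeroLocus S)
    (C' := specZeroLocus (insert f S)) (D := specZeroLocus (algebraMap R T '' S)) (by
      rw [hr]
      ext x
      change insert f S ⊆ (x.asIdeal : Set R) ↔ (S ⊆ (x.asIdeal : Set R) ∧ ¬ ¬ (f ∈ x.asIdeal))
      rw [Set.insert_subset_iff, not_not, and_comm]
      rfl) (by
      change PrimeSpectrum.zeroLocus _ = _ ⁻¹' (PrimeSpectrum.zeroLocus _)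
      exact (PrimeSpectrum.preimage_comap_zeroLocus (algebraMap R T) S).symm)
  rw [show Spec.map (CommRingCat.ofHom (algebraMap R T)) ≫ specMap k R = specMap k T from
    specMap_comp (IsScalarTower.toAlgHom k R T)] at key
  exact key

/-- Inclusion-exclusion for `{f g = 0} = {f = 0} ∪ {g = 0}`: off `{f = 0}` the equations `f g = 0`
and `g = 0` agree, so cutting both along `f` and comparing suffices. -/
theorem zeroClass_mul [Algebra.FiniteType k R] (S : Set R) (f g : R) :
    zeroClass k (insert (f * g) S) + zeroClass k (insert f (insert g S))
      = zeroClass k (insert f S) + zeroClass k (insert g S) := by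
  rw [zeroClass_localization f (Localization.Away f) (insert (f * g) S),
    zeroClass_localization f (Localization.Away f) (insert g S)]
  have h₁ : zeroClass k (insert f (insert (f * g) S)) = zeroClass k (insert f S) := by
    refine zeroClass_congr ?_
    ext x
    simp only [PrimeSpectrum.mem_zeroLocus, Set.insert_subset_iff, SetLike.mem_coe]
    exact ⟨fun h => ⟨h.1, h.2.2⟩, fun h => ⟨h.1, x.asIdeal.mul_mem_right g h.1, h.2⟩⟩
  have h₂ : zeroClass k (algebraMap R (Localization.Away f) '' (insert (f * g) S))
      = zeroClass k (algebraMap R (Localization.Away f) '' (insert g S)) := by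
    refine zeroClass_congr ?_
    ext x
    have hu : algebraMap R (Localization.Away f) f ∉ x.asIdeal := fun h =>
      x.2.ne_top (Ideal.eq_top_of_isUnit_mem _ h (IsLocalization.Away.algebraMap_isUnit f))
    simp only [Set.image_insert_eq, PrimeSpectrum.mem_zeroLocus, Set.insert_subset_iff,
      SetLike.mem_coe, map_mul, x.2.mul_mem_iff_mem_or_mem, hu, false_or]
  rw [h₁, h₂]
  ring

end ZeroClass

end GrothendieckRing

/-! ### Cylinders, and equations linear in one variable. -/

namespace GrothendieckRing

attribute [local instance] CategoryTheory.Over.cartesianMonoidalCategory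
attribute [local instance] CategoryTheory.Over.braidedCategory

section Polynomial

variable {k : Type u} [Field k]

theorem cls_tensorObj (X Y : Var k) : cls (X ⊗ Y) = cls X * cls Y := by
  rw [cls, cls, cls, ← map_mul, generator, generator, generator, ← map_mul,
    Skeleton.toSkeleton_tensorObj]

theorem cls_tensorUnit : cls (𝟙_ (Var k)) = 1 := by
  rw [cls, generator, ← Skeleton.one_eq, map_one, map_one]

theorem zeroClass_field : zeroClass k (∅ : Set k) = 1 := by
  rw [← classOf_specMap, ← cls_tensorUnit, ← classOf_hom]
  congr 1
  exact Spec.map_id _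

variable {R : Type u} [CommRing R] [Algebra k R] [Algebra.FiniteType k R]

/-- The affine line over `R` is the fibre product of `Spec R` and `affineLine k`, and the product of
`K0 k` is induced by fibre products. -/
theorem zeroClass_polynomial_empty :
    zeroClass k (∅ : Set (Polynomial R)) = lefschetz k * zeroClass k (∅ : Set R) := by
  rw [← classOf_specMap, ← classOf_specMap, mul_comm, lefschetz]
  have hR := isVariety_spec k R
  have hP := isVariety_spec k (Polynomial R)
  let e : Limits.pullback (specMap k R) (specMap k (Polynomial k))
      ≅ Spec (CommRingCat.of (Polynomial R)) :=
    pullbackSpecIso k R (Polynomial k) ≪≫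
      Scheme.Spec.mapIso (polyEquivTensor k R).toRingEquiv.toCommRingCatIso.op
  have he : e.hom ≫ specMap k (Polynomial R)
      = Limits.pullback.fst (specMap k R) (specMap k (Polynomial k)) ≫ specMap k R := by
    have h₁ : Spec.map (CommRingCat.ofHom (polyEquivTensor k R).toAlgHom.toRingHom)
        ≫ specMap k (Polynomial R) = specMap k _ := specMap_comp _
    have h₂ : specMap k (TensorProduct k R (Polynomial k))
        = Spec.map (CommRingCat.ofHom Algebra.TensorProduct.includeLeftRingHom) ≫ specMap k R :=
      (specMap_comp (Algebra.TensorProduct.includeLeft :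
        R →ₐ[k] TensorProduct k R (Polynomial k))).symm
    rw [← pullbackSpecIso_hom_fst, Category.assoc]
    erw [← h₂, ← h₁]
    rfl
  let i : (⟨Over.mk (specMap k R), hR⟩ : Var k) ⊗ affineLine k
      ≅ ⟨Over.mk (specMap k (Polynomial R)), hP⟩ :=
    ObjectProperty.isoMk _ (Over.isoMk e he)
  have hi := cls_congr i
  rw [cls_tensorObj] at hi
  rw [classOf, dif_pos hP, classOf, dif_pos hR, ← hi]

theorem zeroClass_polynomial (S : Set R) :
    zeroClass k (Polynomial.C '' S) = lefschetz k * zeroClass k S := by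
  have h₁ := zeroClass_quotient (k := k) S ∅
  have h₂ := zeroClass_of_surjective (k := k)
    (Polynomial.mapAlgHom (Ideal.Quotient.mkₐ k (Ideal.span S)))
    (Polynomial.map_surjective _ (Ideal.Quotient.mkₐ_surjective k _))
    (S := Polynomial.C '' S) (by
      change RingHom.ker (Polynomial.mapRingHom (Ideal.Quotient.mk (Ideal.span S))) ≤ _
      rw [Polynomial.ker_mapRingHom, Ideal.mk_ker, Ideal.map_span])
  rw [Set.image_empty, Set.union_empty] at h₁
  rw [← h₁, ← zeroClass_polynomial_empty, ← h₂]
  refine zeroClass_congr_span ?_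
  rw [Ideal.span_empty, Ideal.span_eq_bot]
  rintro _ ⟨_, ⟨s, hs, rfl⟩, rfl⟩
  have : Ideal.Quotient.mk (Ideal.span S) s = 0 :=
    Ideal.Quotient.eq_zero_iff_mem.mpr (Ideal.subset_span hs)
  change Polynomial.map (Ideal.Quotient.mk (Ideal.span S)) (Polynomial.C s) = 0
  rw [Polynomial.map_C, this, Polynomial.C_0]

theorem zeroClass_X_add_C (b : R) :
    zeroClass k {(Polynomial.X + Polynomial.C b : Polynomial R)} = zeroClass k (∅ : Set R) := by
  let φ : Polynomial R →ₐ[R] R := Polynomial.aeval (-b)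
  rw [← zeroClass_of_surjective (k := k) (φ.restrictScalars k)
    (fun r => ⟨Polynomial.C r, by simp [φ]⟩) (S := {Polynomial.X + Polynomial.C b})]
  · refine zeroClass_congr_span ?_
    simp [φ]
  · intro p hp
    rw [Ideal.mem_span_singleton, ← sub_neg_eq_add, ← Polynomial.C_neg, Polynomial.dvd_iff_isRoot]
    simpa [φ, Polynomial.aeval_def] using hp

/-- Where `a` is invertible, the locus is the graph of `-b / a`, hence isomorphic to `{a ≠ 0}` in
the base. Where `a = 0`, it is the cylinder over `{a = b = 0}`. -/
theorem zeroClass_X_mul_C_add_C (a b : R) :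
    zeroClass k {(Polynomial.X * Polynomial.C a + Polynomial.C b : Polynomial R)}
        + zeroClass k {a}
      = zeroClass k (∅ : Set R) + lefschetz k * zeroClass k {a, b} := by
  let T := Localization.Away a
  have : Algebra.FiniteType R T := IsLocalization.finiteType_of_monoid_fg (.powers a) T
  have : Algebra.FiniteType k T := .trans (S := R) inferInstance inferInstance
  let := Polynomial.algebra R T
  have : IsScalarTower k (Polynomial R) (Polynomial T) := inferInstance
  have hC : IsLocalization.Away (Polynomial.C a) (Polynomial T) := by
    have := Polynomial.isLocalization (.powers a) T
    rwa [Submonoid.map_powers] at this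
  have h₁ := zeroClass_localization (k := k) (Polynomial.C a) (Polynomial T)
    {Polynomial.X * Polynomial.C a + Polynomial.C b}
  have h₂ := zeroClass_localization (k := k) a T ∅
  obtain ⟨c, hc⟩ := IsLocalization.Away.algebraMap_isUnit (S := T) a
  have h₃ : zeroClass k (algebraMap (Polynomial R) (Polynomial T) ''
      {Polynomial.X * Polynomial.C a + Polynomial.C b}) = zeroClass k (∅ : Set T) := by
    rw [← zeroClass_X_add_C (algebraMap R T b * ↑c⁻¹)]
    refine zeroClass_congr_span ?_
    have : algebraMap (Polynomial R) (Polynomial T)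
        (Polynomial.X * Polynomial.C a + Polynomial.C b)
        = (Polynomial.X + Polynomial.C (algebraMap R T b * ↑c⁻¹)) * Polynomial.C (c : T) := by
      rw [add_mul, ← Polynomial.C_mul, mul_assoc, Units.inv_mul, mul_one, hc]
      simp [Polynomial.algebraMap_def]
    rw [Set.image_singleton, this, Ideal.span_singleton_mul_right_unit]
    exact (c.isUnit).map Polynomial.C
  have h₄ : zeroClass k {Polynomial.C a, Polynomial.X * Polynomial.C a + Polynomial.C b}
      = lefschetz k * zeroClass k {a, b} := by
    rw [← zeroClass_polynomial, Set.image_pair]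
    refine zeroClass_congr_span ?_
    rw [add_comm, Ideal.span_pair_comm, Ideal.span_pair_add_mul_right, Ideal.span_pair_comm]
  rw [Set.image_empty] at h₂
  rw [h₁, h₃, h₄, h₂, insert_empty_eq]
  ring

end Polynomial

end GrothendieckRing

/-! ### Elimination of a variable in polynomial rings. -/

namespace GrothendieckRing

section MvPolynomial

variable {k : Type u} [Field k]

theorem zeroClass_insert_X_mul_C_add_C {R : Type u} [CommRing R] [Algebra k R]
    [Algebra.FiniteType k R] (S : Set R) (a b : R) :
    zeroClass k (insert (Polynomial.X * Polynomial.C a + Polynomial.C b) (Polynomial.C '' S))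
        + zeroClass k (insert a S)
      = zeroClass k S + lefschetz k * zeroClass k (insert a (insert b S)) := by
  let q := Ideal.Quotient.mkₐ k (Ideal.span S)
  have hq (T : Set R) : zeroClass k (q '' T) = zeroClass k (S ∪ T) := zeroClass_quotient S T
  have h := zeroClass_X_mul_C_add_C (k := k) (q a) (q b)
  have h₁ : zeroClass k {q a} = zeroClass k (insert a S) := by
    rw [← Set.image_singleton, hq, Set.union_singleton]
  have h₂ : zeroClass k {q a, q b} = zeroClass k (insert a (insert b S)) := by
    rw [← Set.image_pair, hq, Set.union_insert, Set.union_singleton]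
  have h₃ : zeroClass k (∅ : Set (R ⧸ Ideal.span S)) = zeroClass k S := by
    rw [← Set.image_empty q, hq, Set.union_empty]
  let ψ := Polynomial.mapAlgHom (R := k) q
  have h₄ : zeroClass k {Polynomial.X * Polynomial.C (q a) + Polynomial.C (q b)}
      = zeroClass k (insert (Polynomial.X * Polynomial.C a + Polynomial.C b)
          (Polynomial.C '' S)) := by
    have hker : RingHom.ker ψ = Ideal.span (Polynomial.C '' S) := by
      change RingHom.ker (Polynomial.mapRingHom (Ideal.Quotient.mk (Ideal.span S))) = _
      rw [Polynomial.ker_mapRingHom, Ideal.mk_ker, Ideal.map_span]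
    rw [← zeroClass_of_surjective ψ
      (Polynomial.map_surjective _ (Ideal.Quotient.mkₐ_surjective k _))
      (hker.trans_le (Ideal.span_mono (Set.subset_insert _ _)))]
    refine zeroClass_congr_span ?_
    have hab : ψ (Polynomial.X * Polynomial.C a + Polynomial.C b)
        = Polynomial.X * Polynomial.C (q a) + Polynomial.C (q b) := by
      simp [ψ]
    rw [Set.image_insert_eq, Ideal.span_insert, hab, eq_comm, sup_eq_left, Ideal.span_le]
    rintro _ ⟨p, hp, rfl⟩
    have : p ∈ RingHom.ker ψ := hker ▸ Ideal.subset_span hp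
    rw [(RingHom.mem_ker).mp this]
    exact zero_mem _
  rw [← h₁, ← h₂, ← h₃, ← h₄, h]

/-- Allows a zero set in fewer variables to be recorded in the larger ring by adding the equation `X
= 0`, so that later computations can stay in one polynomial ring. -/
theorem zeroClass_insert_X {R : Type u} [CommRing R] [Algebra k R]
    [Algebra.FiniteType k R] (S : Set R) :
    zeroClass k (insert Polynomial.X (Polynomial.C '' S)) = zeroClass k S := by
  have h := zeroClass_insert_X_mul_C_add_C (k := k) S 1 0
  rw [Polynomial.C_0, Polynomial.C_1, mul_one, add_zero,
    zeroClass_eq_zero (Ideal.subset_span (Set.mem_insert _ _)),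
    zeroClass_eq_zero (Ideal.subset_span (Set.mem_insert _ _)), mul_zero, add_zero, add_zero] at h
  exact h

variable {σ : Type u}

open Classical in
/-- Polynomials in the variables `σ`, as polynomials in one variable `e` over the polynomials in
the other variables. -/
def polynomialEquiv (e : σ) :
    MvPolynomial σ k ≃ₐ[k] Polynomial (MvPolynomial {j // j ≠ e} k) :=
  (MvPolynomial.renameEquiv k (Equiv.optionSubtypeNe e).symm).trans
    (MvPolynomial.optionEquivLeft k _)

theorem polynomialEquiv_X (e : σ) :
    polynomialEquiv (k := k) e (MvPolynomial.X e) = Polynomial.X := by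
  classical
  change MvPolynomial.optionEquivLeft k _
    (MvPolynomial.rename (Equiv.optionSubtypeNe e).symm (MvPolynomial.X e)) = _
  rw [MvPolynomial.rename_X, Equiv.optionSubtypeNe_symm_self, MvPolynomial.optionEquivLeft_X_none]

theorem polynomialEquiv_rename (e : σ) (p : MvPolynomial {j // j ≠ e} k) :
    polynomialEquiv e (MvPolynomial.rename Subtype.val p) = Polynomial.C p := by
  suffices h : ((polynomialEquiv (k := k) e).toAlgHom.comp (MvPolynomial.rename Subtype.val))
      = Polynomial.CAlgHom from DFunLike.congr_fun h p
  refine MvPolynomial.algHom_ext fun i => ?_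
  classical
  change MvPolynomial.optionEquivLeft k _ (MvPolynomial.rename (Equiv.optionSubtypeNe e).symm
    (MvPolynomial.rename Subtype.val (MvPolynomial.X i))) = _
  rw [MvPolynomial.rename_X, MvPolynomial.rename_X, Equiv.optionSubtypeNe_symm_of_ne i.2,
    MvPolynomial.optionEquivLeft_X_some]
  rfl

theorem exists_eq_C_of_mem_supported {e : σ} {p : MvPolynomial σ k}
    (hp : p ∈ MvPolynomial.supported k {e}ᶜ) :
    ∃ q, polynomialEquiv e p = Polynomial.C q := by
  rw [MvPolynomial.supported_eq_range_rename] at hp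
  obtain ⟨q, rfl⟩ := hp
  exact ⟨q, polynomialEquiv_rename e q⟩

theorem exists_image_eq_of_subset_supported {e : σ} {S : Set (MvPolynomial σ k)}
    (hS : S ⊆ MvPolynomial.supported k {e}ᶜ) :
    ∃ T, polynomialEquiv e '' S = Polynomial.C '' T := by
  refine ⟨Polynomial.C ⁻¹' (polynomialEquiv e '' S), ?_⟩
  rw [Set.image_preimage_eq_of_subset]
  rintro _ ⟨p, hp, rfl⟩
  obtain ⟨q, hq⟩ := exists_eq_C_of_mem_supported (hS hp)
  exact ⟨q, hq.symm⟩

variable [Finite σ]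

/-- The class of a cylinder in the direction of the variable `e`. -/
theorem zeroClass_of_subset_supported {e : σ} {S : Set (MvPolynomial σ k)}
    (hS : S ⊆ MvPolynomial.supported k {e}ᶜ) :
    zeroClass k S = lefschetz k * zeroClass k (insert (MvPolynomial.X e) S) := by
  obtain ⟨T, hT⟩ := exists_image_eq_of_subset_supported hS
  rw [← zeroClass_of_algEquiv (polynomialEquiv e) S,
    ← zeroClass_of_algEquiv (polynomialEquiv e) (insert _ S), Set.image_insert_eq, hT,
    polynomialEquiv_X, zeroClass_insert_X, zeroClass_polynomial]

/-- The class of the zero set of `t_e A + B`, where `A` and `B` do not involve `t_e`. -/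
theorem zeroClass_linear {e : σ} {S : Set (MvPolynomial σ k)} {A B : MvPolynomial σ k}
    (hS : S ⊆ MvPolynomial.supported k {e}ᶜ) (hA : A ∈ MvPolynomial.supported k {e}ᶜ)
    (hB : B ∈ MvPolynomial.supported k {e}ᶜ) :
    zeroClass k (insert (MvPolynomial.X e * A + B) S)
        + zeroClass k (insert A (insert (MvPolynomial.X e) S))
      = zeroClass k (insert (MvPolynomial.X e) S)
        + lefschetz k * zeroClass k (insert A (insert B (insert (MvPolynomial.X e) S))) := by
  obtain ⟨T, hT⟩ := exists_image_eq_of_subset_supported hS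
  obtain ⟨a, ha⟩ := exists_eq_C_of_mem_supported hA
  obtain ⟨b, hb⟩ := exists_eq_C_of_mem_supported hB
  have hi (U : Set (MvPolynomial σ k)) := zeroClass_of_algEquiv (polynomialEquiv e) U
  rw [← hi, ← hi (insert A _), ← hi (insert _ S), ← hi (insert A (insert B _))]
  simp only [Set.image_insert_eq, map_add, map_mul, hT, ha, hb, polynomialEquiv_X]
  rw [Set.insert_comm _ Polynomial.X, Set.insert_comm _ Polynomial.X,
    Set.insert_comm _ Polynomial.X, ← Set.image_insert_eq, ← Set.image_insert_eq,
    ← Set.image_insert_eq, zeroClass_insert_X, zeroClass_insert_X, zeroClass_insert_X,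
    zeroClass_insert_X_mul_C_add_C]

end MvPolynomial

end GrothendieckRing

/-! ### Dehomogenization and the standard charts of projective space. -/

namespace MvPolynomial.IsHomogeneous

/-- Used with `u = t_i` and `y j = t_j / t_i` to clear the denominators of a dehomogenized
polynomial. -/
theorem eval₂_mul_left {σ R B : Type*} [CommSemiring R] [CommSemiring B] {p : MvPolynomial σ R}
    {n : ℕ} (hp : p.IsHomogeneous n) (g : R →+* B) (u : B) (y : σ → B) :
    p.eval₂ g (fun j => u * y j) = u ^ n * p.eval₂ g y := by
  rw [MvPolynomial.eval₂_eq, MvPolynomial.eval₂_eq, Finset.mul_sum]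
  refine Finset.sum_congr rfl fun m hm => ?_
  have hd : ∑ i ∈ m.support, m i = n := (hp.degree_eq_sum_deg_support hm).symm
  simp only [mul_pow, Finset.prod_mul_distrib, Finset.prod_pow_eq_pow_sum, hd]
  ring

end MvPolynomial.IsHomogeneous

namespace ProjectiveHypersurface

open GrothendieckRing HomogeneousLocalization

attribute [local instance] MvPolynomial.gradedAlgebra

variable {σ : Type u} {k : Type u} [Field k]

local notation "Hm" => MvPolynomial.homogeneousSubmodule σ k

theorem X_mem_homogeneousSubmodule (i : σ) :
    (MvPolynomial.X i : MvPolynomial σ k) ∈ MvPolynomial.homogeneousSubmodule σ k 1 :=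
  MvPolynomial.isHomogeneous_X k i

/-- Dehomogenization with respect to the coordinate `i`, that is substituting `t_j / t_i` for
`t_j`. -/
def dehomogenize (i : σ) :
    MvPolynomial σ k →+* Away (MvPolynomial.homogeneousSubmodule σ k) (MvPolynomial.X i) :=
  MvPolynomial.eval₂Hom ((fromZeroRingHom (MvPolynomial.homogeneousSubmodule σ k) _).comp
      (algebraMap k (MvPolynomial.homogeneousSubmodule σ k 0)))
    fun j => Away.mk _ (X_mem_homogeneousSubmodule i) 1 (MvPolynomial.X j)
      (X_mem_homogeneousSubmodule j)

/-- The quotient `t_j / t_i` in the localization at `t_i`. -/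
def coordQuotient (k : Type u) [Field k] (i j : σ) :
    Localization.Away (MvPolynomial.X i : MvPolynomial σ k) :=
  IsLocalization.mk' _ (MvPolynomial.X j) (⟨MvPolynomial.X i, Submonoid.mem_powers _⟩ :
    Submonoid.powers (MvPolynomial.X i : MvPolynomial σ k))

theorem mul_coordQuotient (i j : σ) :
    algebraMap (MvPolynomial σ k) (Localization.Away (MvPolynomial.X i : MvPolynomial σ k))
      (MvPolynomial.X i) * coordQuotient k i j = algebraMap (MvPolynomial σ k) _ (MvPolynomial.X j) :=
  IsLocalization.mk'_spec' _ _ (⟨MvPolynomial.X i, Submonoid.mem_powers _⟩ :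
    Submonoid.powers (MvPolynomial.X i : MvPolynomial σ k))

theorem val_dehomogenize (i : σ) (p : MvPolynomial σ k) :
    (dehomogenize i p).val =
      MvPolynomial.eval₂ (algebraMap k (Localization.Away _)) (coordQuotient k i) p := by
  rw [← HomogeneousLocalization.algebraMap_apply, dehomogenize, MvPolynomial.coe_eval₂Hom,
    MvPolynomial.hom_eval₂]
  refine congrArg (MvPolynomial.eval₂ _ · p) (funext fun j => ?_)
  rw [HomogeneousLocalization.algebraMap_apply, Away.val_mk,
    Localization.mk_eq_mk', coordQuotient]
  congr 2
  exact pow_one _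

theorem eval₂_comp_C (p : MvPolynomial σ k) {B : Type u} [CommRing B]
    (g : MvPolynomial σ k →+* B) :
    MvPolynomial.eval₂ (g.comp MvPolynomial.C) (fun j => g (MvPolynomial.X j)) p = g p := by
  have := MvPolynomial.hom_eval₂ p MvPolynomial.C g MvPolynomial.X
  rw [MvPolynomial.eval₂_eta] at this
  exact this.symm

theorem dehomogenize_of_mem (i : σ) {p : MvPolynomial σ k} {n : ℕ}
    (hp : p ∈ MvPolynomial.homogeneousSubmodule σ k (n • 1)) :
    dehomogenize i p = Away.mk _ (X_mem_homogeneousSubmodule i) n p hp := by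
  have hh : p.IsHomogeneous n := by simpa using hp
  apply HomogeneousLocalization.val_injective
  rw [val_dehomogenize, Away.val_mk, Localization.mk_eq_mk', IsLocalization.eq_mk'_iff_mul_eq,
    mul_comm, map_pow, ← hh.eval₂_mul_left]
  simp only [mul_coordQuotient]
  exact eval₂_comp_C p (algebraMap _ _)

theorem dehomogenize_surjective (i : σ) : Function.Surjective (dehomogenize (k := k) i) := by
  intro z
  obtain ⟨n, a, ha, rfl⟩ := Away.mk_surjective _ (X_mem_homogeneousSubmodule i) z
  exact ⟨a, dehomogenize_of_mem i ha⟩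

theorem dehomogenize_X_self (i : σ) : dehomogenize (k := k) i (MvPolynomial.X i) = 1 := by
  rw [dehomogenize_of_mem i (n := 1) (X_mem_homogeneousSubmodule i)]
  apply HomogeneousLocalization.val_injective
  rw [Away.val_mk, HomogeneousLocalization.val_one]
  convert! Localization.mk_self _ using 2
  simp

/-- Together with surjectivity, this embeds the chart `t_i ≠ 0` in affine space as a closed
subscheme with support `{t_i = 1}`, without changing the index set of the variables. -/
theorem ker_dehomogenize (i : σ) :
    RingHom.ker (dehomogenize (k := k) i) ≤ Ideal.span {MvPolynomial.X i - 1} := by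
  let I := Ideal.span {(MvPolynomial.X i - 1 : MvPolynomial σ k)}
  have hX : Ideal.Quotient.mk I (MvPolynomial.X i) = 1 := by
    rw [← map_one (Ideal.Quotient.mk I), Ideal.Quotient.mk_eq_mk_iff_sub_mem]
    exact Ideal.subset_span rfl
  -- Modulo `t_i - 1` the coordinate `t_i` becomes invertible, and `θ` sends `t_j / t_i` back to
  -- `t_j`. Hence the dehomogenization of `p` determines `p` modulo `t_i - 1`.
  let θ : Localization.Away (MvPolynomial.X i : MvPolynomial σ k) →+* MvPolynomial σ k ⧸ I :=
    IsLocalization.Away.lift (MvPolynomial.X i) (g := Ideal.Quotient.mk I) (by rw [hX]; exact isUnit_one)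
  have hθ (a : MvPolynomial σ k) : θ (algebraMap _ _ a) = Ideal.Quotient.mk I a :=
    IsLocalization.Away.lift_eq _ _ a
  have key (p : MvPolynomial σ k) : θ (dehomogenize i p).val = Ideal.Quotient.mk I p := by
    have hj (j : σ) : θ (coordQuotient k i j) = Ideal.Quotient.mk I (MvPolynomial.X j) := by
      have := congrArg θ (mul_coordQuotient (k := k) i j)
      rwa [map_mul, hθ, hθ, hX, one_mul] at this
    have hC : θ.comp (algebraMap k (Localization.Away (MvPolynomial.X i : MvPolynomial σ k)))
        = (Ideal.Quotient.mk I).comp MvPolynomial.C := RingHom.ext fun a => hθ (MvPolynomial.C a)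
    rw [val_dehomogenize, MvPolynomial.hom_eval₂, hC, ← eval₂_comp_C p (Ideal.Quotient.mk I)]
    exact congrArg (MvPolynomial.eval₂ _ · p) (funext hj)
  intro p hp
  rw [← Ideal.Quotient.eq_zero_iff_mem, ← key, (RingHom.mem_ker).mp hp]
  simp

variable (k) in
/-- The open immersion of the standard affine chart `t_i ≠ 0` into projective space. -/
def chart (i : σ) :
    Spec (CommRingCat.of (Away (MvPolynomial.homogeneousSubmodule σ k) (MvPolynomial.X i))) ⟶
      projectiveSpace σ k :=
  Proj.awayι Hm (MvPolynomial.X i) (X_mem_homogeneousSubmodule i) one_pos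

instance (i : σ) : IsOpenImmersion (chart k i) :=
  inferInstanceAs (IsOpenImmersion (Proj.awayι Hm (MvPolynomial.X i)
    (X_mem_homogeneousSubmodule i) one_pos))

theorem chart_structureMap (i : σ) :
    chart k i ≫ structureMap σ k
      = Spec.map (CommRingCat.ofHom (dehomogenize i)) ≫ specMap k (MvPolynomial σ k) := by
  refine (Category.assoc _ _ _).symm.trans ?_
  erw [Proj.awayι_toSpecZero]
  rw [← Spec.map_comp, ← Spec.map_comp, ← CommRingCat.ofHom_comp, ← CommRingCat.ofHom_comp]
  congr 2
  ext a
  simp [dehomogenize]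

theorem mem_range_chart (i : σ) (x : ProjectiveSpectrum (MvPolynomial.homogeneousSubmodule σ k)) :
    x ∈ Set.range (chart k i) ↔ MvPolynomial.X i ∉ x.asHomogeneousIdeal := by
  have := Proj.opensRange_awayι (MvPolynomial.homogeneousSubmodule σ k) (MvPolynomial.X i)
    (X_mem_homogeneousSubmodule i) one_pos
  change x ∈ (Proj.awayι Hm (MvPolynomial.X i) _ _).opensRange ↔ _
  rw [this]
  rfl

theorem mem_chart_iff (i : σ) {n : ℕ} (hn : 0 < n) {p : MvPolynomial σ k}
    (hp : p.IsHomogeneous n)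
    (x : Spec (CommRingCat.of (Away (MvPolynomial.homogeneousSubmodule σ k) (MvPolynomial.X i)))) :
    p ∈ (chart k i x : ProjectiveSpectrum Hm).asHomogeneousIdeal ↔
      dehomogenize i p ∈ (x : PrimeSpectrum _).asIdeal := by
  have h := Proj.awayι_preimage_basicOpen Hm (X_mem_homogeneousSubmodule i) one_pos
    (show p ∈ Hm n from hp) hn
  have h' : x ∈ Proj.awayι Hm (MvPolynomial.X i) (X_mem_homogeneousSubmodule i) one_pos ⁻¹ᵁ
      Proj.basicOpen Hm p ↔ x ∈ PrimeSpectrum.basicOpen (Away.isLocalizationElem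
        (X_mem_homogeneousSubmodule i) (show p ∈ Hm n from hp)) := by rw [h]; rfl
  have e : Away.isLocalizationElem (X_mem_homogeneousSubmodule i) (show p ∈ Hm n from hp)
      = dehomogenize i p := by
    rw [dehomogenize_of_mem i (n := n) (by simpa using hp)]
    apply HomogeneousLocalization.val_injective
    simp
  rw [e] at h'
  exact not_iff_not.mp h'

end ProjectiveHypersurface

/-! ### Cutting projective zero sets by a coordinate hyperplane. -/

namespace ProjectiveHypersurface

open GrothendieckRing HomogeneousLocalization

attribute [local instance] MvPolynomial.gradedAlgebra

variable {σ : Type u} {k : Type u} [Field k]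

/-- The closed set `{S = 0}` in projective space. -/
def projZeroLocus (S : Set (MvPolynomial σ k)) :
    TopologicalSpace.Closeds (projectiveSpace σ k) where
  carrier := ProjectiveSpectrum.zeroLocus (MvPolynomial.homogeneousSubmodule σ k) S
  isClosed' := ProjectiveSpectrum.isClosed_zeroLocus _ _

/-- The class in `K₀(Var_k)` of the closed set `{S = 0}` in projective space. -/
def projClass (S : Set (MvPolynomial σ k)) : K0 k :=
  closedClass (structureMap σ k) (projZeroLocus S)

theorem cls_hypersurfaceVar [Finite σ] (f : MvPolynomial σ k) :
    cls (hypersurfaceVar f) = projClass {f} :=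
  (classOf_hom (hypersurfaceVar f)).symm

theorem projClass_eq_zero {S : Set (MvPolynomial σ k)} (hS : ∀ i, MvPolynomial.X i ∈ S) :
    projClass S = 0 := by
  have : projZeroLocus S = ⊥ := by
    refine TopologicalSpace.Closeds.ext (Set.eq_empty_of_forall_notMem fun x hx => ?_)
    refine x.not_irrelevant_le ((HomogeneousIdeal.toIdeal_irrelevant_le _).mpr fun n hn p hp => ?_)
    have hX (i : σ) : MvPolynomial.X i ∈ x.asHomogeneousIdeal := hx (hS i)
    have hp : p.IsHomogeneous n := hp
    change p ∈ x.asHomogeneousIdeal.toIdeal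
    rw [p.as_sum]
    refine Ideal.sum_mem _ fun m hm => ?_
    -- A monomial of positive degree is divisible by some variable, so a point where all variables
    -- vanish would contain the irrelevant ideal.
    obtain ⟨i, hi⟩ : ∃ i, m i ≠ 0 := by
      by_contra! h
      have hd := hp.degree_eq_sum_deg_support hm
      rw [Finset.sum_eq_zero fun i _ => h i] at hd
      omega
    have : MvPolynomial.X i ∣ MvPolynomial.monomial m (MvPolynomial.coeff m p) :=
      MvPolynomial.X_dvd_monomial.mpr (Or.inr hi)
    exact Ideal.mem_of_dvd _ this (hX i)
  rw [projClass, this, closedClass_bot]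

/-- The closed piece is the section by `t_i = 0`. The open piece lies in the chart `t_i ≠ 0`, which
is identified with the affine slice `t_i = 1`. -/
theorem projClass_eq_add [Finite σ] {S : Set (MvPolynomial σ k)}
    (hS : ∀ p ∈ S, ∃ n, 0 < n ∧ p.IsHomogeneous n) (i : σ) :
    projClass S = projClass (insert (MvPolynomial.X i) S)
      + zeroClass k (insert (MvPolynomial.X i - 1) S) := by
  let D : TopologicalSpace.Closeds (Spec (CommRingCat.of
      (Away (MvPolynomial.homogeneousSubmodule σ k) (MvPolynomial.X i)))) :=
    specZeroLocus (dehomogenize i '' insert (MvPolynomial.X i - 1) S)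
  have hD : (D : Set (Spec (CommRingCat.of
      (Away (MvPolynomial.homogeneousSubmodule σ k) (MvPolynomial.X i)))))
      = chart k i ⁻¹' (projZeroLocus S : Set (projectiveSpace σ k)) := by
    ext x
    refine (PrimeSpectrum.mem_zeroLocus _ _).trans (Iff.trans ?_
      (ProjectiveSpectrum.mem_zeroLocus _ (chart k i x) S).symm)
    rw [Set.image_insert_eq, map_sub, dehomogenize_X_self, map_one, sub_self,
      Set.insert_subset_iff, Set.image_subset_iff]
    constructor
    · rintro ⟨-, h⟩ p hp
      obtain ⟨n, hn, hpn⟩ := hS p hp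
      exact (mem_chart_iff i hn hpn x).mpr (h hp)
    · refine fun h => ⟨zero_mem _, fun p hp => ?_⟩
      obtain ⟨n, hn, hpn⟩ := hS p hp
      exact (mem_chart_iff i hn hpn x).mp (h hp)
  have key := closedClass_eq_add isVariety_projectiveSpace (chart k i) (C := projZeroLocus S)
    (C' := projZeroLocus (insert (MvPolynomial.X i) S)) (D := D) (by
      ext x
      rw [Set.mem_sdiff]
      refine Iff.trans ?_ (and_congr_right' (not_congr (mem_range_chart i x)).symm)
      change insert _ S ⊆ _ ↔ S ⊆ _ ∧ _
      rw [Set.insert_subset_iff, not_not, and_comm]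
      rfl) hD
  rw [projClass, key]
  congr 1
  have : IsClosedImmersion (Spec.map (CommRingCat.ofHom (dehomogenize (k := k) i))) :=
    IsClosedImmersion.spec_of_surjective _ (dehomogenize_surjective i)
  rw [chart_structureMap]
  refine closedClass_of_isClosedImmersion (isVariety_spec k _) _ ?_
  change PrimeSpectrum.comap (dehomogenize i) '' PrimeSpectrum.zeroLocus _
    = PrimeSpectrum.zeroLocus _
  rw [← PrimeSpectrum.zeroLocus_span (_ '' _),
    image_comap_zeroLocus_eq_zeroLocus_comap _ _ (dehomogenize_surjective i),
    ← PrimeSpectrum.zeroLocus_span (insert _ S), ← Ideal.map_span,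
    Ideal.comap_map_of_surjective _ (dehomogenize_surjective i)]
  congr 2
  refine sup_eq_left.mpr ((ker_dehomogenize i).trans (Ideal.span_mono ?_))
  exact Set.singleton_subset_iff.mpr (Set.mem_insert _ _)

end ProjectiveHypersurface

/-! ### Affine strata, and the effect of attaching a polygon on classes. -/

namespace GrothendieckRing

open MvPolynomial

variable {k : Type u} [Field k] {σ : Type u}

theorem lefschetz_mem_tateSubring : lefschetz k ∈ tateSubring k :=
  Subring.subset_closure rfl

variable (k) in
/-- Equations for the affine space given in homogeneous coordinates by `t_j = 0` for `j ∈ Z` and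
`t_i = 1`. -/
def stratum (Z : Set σ) (i : σ) : Set (MvPolynomial σ k) :=
  insert (X i - 1) (X '' Z)

theorem X_image_subset_supported (Z : Set σ) :
    (X '' Z : Set (MvPolynomial σ k)) ⊆ supported k Z := by
  rintro _ ⟨z, hz, rfl⟩
  exact X_mem_supported.mpr hz

theorem stratum_subset_supported (Z : Set σ) (i : σ) :
    stratum k Z i ⊆ supported k (insert i Z) := by
  refine Set.insert_subset ?_ ((X_image_subset_supported Z).trans
    (supported_mono (Set.subset_insert i Z)))
  exact sub_mem (X_mem_supported.mpr (Set.mem_insert i Z)) (one_mem _)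

theorem stratum_insert (Z : Set σ) (i j : σ) :
    stratum k (insert j Z) i = insert (X j) (stratum k Z i) := by
  rw [stratum, stratum, Set.image_insert_eq, Set.insert_comm]

theorem stratum_union (Z W : Set σ) (i : σ) :
    stratum k (W ∪ Z) i = X '' W ∪ stratum k Z i := by
  rw [stratum, stratum, Set.image_union, Set.union_insert]

variable [Finite σ]

theorem zeroClass_eq_pow_mul (W : Finset σ) {S : Set (MvPolynomial σ k)}
    (hS : S ⊆ supported k (W : Set σ)ᶜ) :
    zeroClass k S = lefschetz k ^ W.card * zeroClass k (X '' (W : Set σ) ∪ S) := by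
  classical
  induction W using Finset.induction_on with
  | empty => simp
  | insert e W he ih =>
    rw [ih (hS.trans (supported_mono (by simp))), Finset.card_insert_of_notMem he, pow_succ,
      mul_assoc, zeroClass_of_subset_supported (e := e)
        (Set.union_subset ((X_image_subset_supported _).trans (supported_mono ?_))
          (hS.trans (supported_mono (by simp)))), Finset.coe_insert, Set.image_insert_eq,
      Set.insert_union]
    exact Set.subset_compl_singleton_iff.mpr (by simpa using he)

theorem zeroClass_range_X : zeroClass k (Set.range (X : σ → MvPolynomial σ k)) = 1 := by
  let φ : MvPolynomial σ k →ₐ[k] k := aeval 0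
  rw [← zeroClass_of_surjective φ (fun a => ⟨C a, by simp [φ]⟩), ← zeroClass_field]
  · refine zeroClass_congr_span ?_
    rw [Ideal.span_empty, Ideal.span_eq_bot]
    rintro _ ⟨_, ⟨j, rfl⟩, rfl⟩
    simp [φ]
  · intro p hp
    have : constantCoeff p = 0 := by
      have : φ p = 0 := hp
      rwa [aeval_zero] at this
    rw [← Set.image_univ]
    rw [mem_ideal_span_X_image]
    intro m hm
    by_contra! h
    have : m = 0 := Finsupp.ext fun j => h j (Set.mem_univ j)
    subst this
    exact mem_support_iff.mp hm (by assumption)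

/-- The case of leading coefficient `1`: solve the equation for `X e`. -/
theorem zeroClass_X_add {e : σ} {S : Set (MvPolynomial σ k)} {B : MvPolynomial σ k}
    (hS : S ⊆ supported k {e}ᶜ) (hB : B ∈ supported k {e}ᶜ) :
    zeroClass k (insert (X e + B) S) = zeroClass k (insert (X e) S) := by
  have h := zeroClass_linear hS (one_mem _) hB
  rwa [zeroClass_eq_zero (Ideal.subset_span (Set.mem_insert _ _)),
    zeroClass_eq_zero (Ideal.subset_span (Set.mem_insert _ _)), mul_one, mul_zero, add_zero,
    add_zero] at h

/-- Imposing fewer of the equations `t_j = 0` in a stratum multiplies the class by a power of `𝕃`,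
if the other equations do not involve these `t_j`. -/
theorem zeroClass_union_stratum {Z : Set σ} {i : σ} (hi : i ∉ Z) {W : Finset σ}
    (hW : (W : Set σ) ⊆ Z) {S : Set (MvPolynomial σ k)} (hS : S ⊆ supported k (W : Set σ)ᶜ) :
    zeroClass k (S ∪ stratum k (Z \ W) i)
      = lefschetz k ^ W.card * zeroClass k (S ∪ stratum k Z i) := by
  rw [zeroClass_eq_pow_mul W, Set.union_left_comm, ← stratum_union, Set.union_sdiff_cancel hW]
  refine Set.union_subset hS ((stratum_subset_supported _ _).trans (supported_mono ?_))
  refine Set.insert_subset (fun h => hi (hW h)) fun j hj => hj.2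

theorem zeroClass_stratum_mem {Z : Set σ} {i : σ} (hi : i ∉ Z) :
    zeroClass k (stratum k Z i) ∈ tateSubring k := by
  classical
  have := Fintype.ofFinite σ
  -- For `Z = {i}ᶜ` the stratum is a single rational point; freeing the coordinates outside `insert
  -- i Z` turns it into an affine space of the right dimension.
  have h := zeroClass_union_stratum (k := k) (Z := {i}ᶜ) (i := i) (by simp)
    (W := (insert i Z)ᶜ.toFinset) (by simp [Set.subset_def]) (Set.empty_subset _)
  have hZ : ({i}ᶜ \ ((insert i Z)ᶜ.toFinset : Set σ)) = Z := by
    ext j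
    simp only [Set.coe_toFinset, Set.mem_sdiff, Set.mem_compl_iff, Set.mem_insert_iff,
      Set.mem_singleton_iff]
    constructor
    · tauto
    · exact fun hj => ⟨fun h => hi (h ▸ hj), by tauto⟩
  have h₁ : zeroClass k (stratum k ({i}ᶜ : Set σ) i) = 1 := by
    have h₀ := zeroClass_X_add (k := k) (e := i) (B := (-1 : MvPolynomial σ k)) (X_image_subset_supported _)
      (neg_mem (one_mem _))
    rw [stratum, sub_eq_add_neg, h₀, ← zeroClass_range_X (σ := σ), ← Set.image_insert_eq, ← Set.image_univ]
    congr 2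
    ext j
    simp [em]
  rw [hZ, Set.empty_union, Set.empty_union, h₁, mul_one] at h
  rw [h]
  exact pow_mem lefschetz_mem_tateSubring _

/-- If some `f ∈ P` is neither set to `0` nor normalized, solve for `X f` and get an affine space.
Otherwise the sum reduces to `X i = 1` on the stratum, and the locus is empty. -/
theorem zeroClass_sum_stratum_mem {Z : Set σ} {i : σ} (hi : i ∉ Z) {P : Finset σ} (hP : i ∈ P) :
    zeroClass k (insert (∑ e ∈ P, X e) (stratum k Z i)) ∈ tateSubring k := by
  classical
  by_cases h : ∃ f ∈ P, f ∉ Z ∧ f ≠ i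
  · obtain ⟨f, hf, hfZ, hfi⟩ := h
    rw [← Finset.add_sum_erase P X hf, zeroClass_X_add, ← stratum_insert]
    · exact zeroClass_stratum_mem (by simp [hi, hfi.symm])
    · refine (stratum_subset_supported _ _).trans (supported_mono ?_)
      exact Set.subset_compl_singleton_iff.mpr (by simp [hfi, hfZ])
    · refine sum_mem fun e he => X_mem_supported.mpr ?_
      exact (Finset.mem_erase.mp he).1
  · push Not at h
    rw [zeroClass_eq_zero]
    · exact zero_mem _
    · have h₁ : (∑ e ∈ P, X e : MvPolynomial σ k)
          ∈ Ideal.span (insert (∑ e ∈ P, X e) (stratum k Z i)) :=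
        Ideal.subset_span (Set.mem_insert _ _)
      have h₂ : (X i - 1 : MvPolynomial σ k)
          ∈ Ideal.span (insert (∑ e ∈ P, X e) (stratum k Z i)) :=
        Ideal.subset_span (Set.mem_insert_of_mem _ (Set.mem_insert _ _))
      have h₃ : (∑ e ∈ P.erase i, X e : MvPolynomial σ k)
          ∈ Ideal.span (insert (∑ e ∈ P, X e) (stratum k Z i)) :=
        sum_mem fun e he => Ideal.subset_span (Set.mem_insert_of_mem _ (Set.mem_insert_of_mem _
          ⟨e, by_contra fun hZ => (Finset.mem_erase.mp he).1 (h e (Finset.mem_erase.mp he).2 hZ),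
            rfl⟩))
      have h₄ : (∑ e ∈ P, X e) - (∑ e ∈ P.erase i, X e) - (X i - 1 : MvPolynomial σ k) = 1 := by
        rw [← Finset.add_sum_erase P X hP]
        ring
      exact h₄ ▸ sub_mem (sub_mem h₁ h₃) h₂

section Attach

variable {Z : Set σ} {i : σ} {N : Finset σ} {A B : MvPolynomial σ k}

/-- For any `f ∈ N` the equation is linear in `X f` with coefficient `A`, and on `{A = 0}` its
constant term reduces to `B`. The other variables of `N` are free in `{A = 0}` and `{A = B = 0}`,
and contribute powers of `𝕃`. Passing from `Z` to `Z \ N` in the stratum is what frees the variables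
of `N`. -/
theorem zeroClass_attach_mem [DecidableEq σ] (hi : i ∉ Z) (hN : (N : Set σ) ⊆ Z)
    (hA : A ∈ supported k (N : Set σ)ᶜ) (hB : B ∈ supported k (N : Set σ)ᶜ)
    (h₁ : zeroClass k (insert A (stratum k Z i)) ∈ tateSubring k)
    (h₂ : zeroClass k (insert A (insert B (stratum k Z i))) ∈ tateSubring k)
    (hne : N.Nonempty) :
    zeroClass k (insert ((∑ f ∈ N, X f) * A + B) (stratum k (Z \ N) i)) ∈ tateSubring k := by
  obtain ⟨f, hf⟩ := hne
  have hfi : f ≠ i := fun h => hi (h ▸ hN hf)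
  have hsub : ({f}ᶜ : Set σ) ⊇ (N : Set σ)ᶜ := by simpa using hf
  have he : ((N.erase f : Finset σ) : Set σ) ⊆ N := by simp
  have hst : insert (X f) (stratum k (Z \ N) i) = stratum k (Z \ (N.erase f : Finset σ)) i := by
    rw [← stratum_insert]
    congr 1
    ext j
    have := @hN f hf
    by_cases hj : j = f <;> simp_all
  have hcyl (S : Set (MvPolynomial σ k)) (hS : S ⊆ supported k (N : Set σ)ᶜ) :=
    zeroClass_union_stratum (k := k) hi (he.trans hN)
      (hS.trans (supported_mono (Set.compl_subset_compl.mpr he)))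
  have hpow := pow_mem (lefschetz_mem_tateSubring (k := k)) (N.erase f).card
  have key := zeroClass_linear (k := k) (e := f) (S := stratum k (Z \ N) i) (A := A)
    (B := (∑ g ∈ N.erase f, X g) * A + B) ?_ (supported_mono hsub hA) ?_
  · rw [hst] at key
    have e₁ := hcyl {A} (by simpa using hA)
    have e₂ := hcyl {A, B} (by simpa [Set.insert_subset_iff] using ⟨hA, hB⟩)
    rw [Set.singleton_union, Set.singleton_union] at e₁
    rw [Set.insert_union, Set.singleton_union, Set.insert_union, Set.singleton_union] at e₂
    have e₃ : zeroClass k (insert A (insert ((∑ g ∈ N.erase f, X g) * A + B)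
        (stratum k (Z \ (N.erase f : Finset σ)) i)))
        = zeroClass k (insert A (insert B (stratum k (Z \ (N.erase f : Finset σ)) i))) := by
      refine zeroClass_congr ?_
      ext x
      simp only [PrimeSpectrum.mem_zeroLocus, Set.insert_subset_iff, SetLike.mem_coe]
      refine and_congr_right fun hx => and_congr_left fun _ => ?_
      exact Submodule.add_mem_iff_right _ (x.asIdeal.mul_mem_left _ hx)
    rw [e₁, e₃, e₂, ← add_assoc, ← add_mul, Finset.add_sum_erase _ _ hf,
      ← eq_sub_iff_add_eq] at key
    rw [key]
    refine sub_mem (add_mem ?_ (mul_mem lefschetz_mem_tateSubring (mul_mem hpow h₂)))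
      (mul_mem hpow h₁)
    exact zeroClass_stratum_mem fun h => hi h.1
  · refine (stratum_subset_supported _ _).trans (supported_mono ?_)
    exact Set.subset_compl_singleton_iff.mpr (by simp [hfi, hf])
  · refine add_mem (mul_mem (sum_mem fun g hg => X_mem_supported.mpr ?_)
      (supported_mono hsub hA)) (supported_mono hsub hB)
    exact (Finset.mem_erase.mp hg).1

/-- Subtracting the second equation from `X u` times the first leaves `X u ^ 2 * A`, so
set-theoretically the second equation may be replaced by `X u * A = 0`, to which `zeroClass_mul`
applies. -/
theorem zeroClass_attach_pair_mem [DecidableEq σ] (hi : i ∉ Z) (hN : (N : Set σ) ⊆ Z)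
    (hA : A ∈ supported k (N : Set σ)ᶜ) (hB : B ∈ supported k (N : Set σ)ᶜ)
    (h₁ : zeroClass k (insert A (stratum k Z i)) ∈ tateSubring k)
    (h₂ : zeroClass k (insert A (insert B (stratum k Z i))) ∈ tateSubring k)
    {u : σ} (hu : u ∈ N) (hne : (N.erase u).Nonempty) :
    zeroClass k (insert ((∑ f ∈ N, X f) * A + B)
      (insert (X u * ((∑ f ∈ N.erase u, X f) * A + B)) (stratum k (Z \ N) i)))
      ∈ tateSubring k := by
  have he : ((N.erase u : Finset σ) : Set σ) ⊆ N := by simp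
  have hst : insert (X u) (stratum k (Z \ N) i) = stratum k (Z \ (N.erase u : Finset σ)) i := by
    rw [← stratum_insert]
    congr 1
    ext j
    have := @hN u hu
    by_cases hj : j = u <;> simp_all
  have hsub := supported_mono (R := k) (Set.compl_subset_compl.mpr he)
  have hpow (n : ℕ) := pow_mem (lefschetz_mem_tateSubring (k := k)) n
  have key := zeroClass_mul (k := k) (insert ((∑ f ∈ N, X f) * A + B) (stratum k (Z \ N) i))
    (X u) A
  rw [← Finset.add_sum_erase N X hu] at key ⊢
  set s : MvPolynomial σ k := ∑ f ∈ N.erase u, X f with hs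
  have e₀ : zeroClass k (insert ((X u + s) * A + B)
      (insert (X u * (s * A + B)) (stratum k (Z \ N) i)))
      = zeroClass k (insert (X u * A) (insert ((X u + s) * A + B) (stratum k (Z \ N) i))) := by
    refine zeroClass_congr ?_
    ext x
    simp only [PrimeSpectrum.mem_zeroLocus, Set.insert_subset_iff, SetLike.mem_coe]
    constructor
    · rintro ⟨h₁, h₂, h₃⟩
      refine ⟨?_, h₁, h₃⟩
      have : X u * (X u * A) ∈ x.asIdeal := by
        convert! sub_mem (x.asIdeal.mul_mem_left (X u) h₁) h₂ using 1
        ring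
      rcases x.2.mem_or_mem this with h | h
      · exact x.asIdeal.mul_mem_right _ h
      · exact h
    · rintro ⟨h₁, h₂, h₃⟩
      refine ⟨h₂, ?_, h₃⟩
      convert! sub_mem (x.asIdeal.mul_mem_left (X u) h₂) (x.asIdeal.mul_mem_left (X u) h₁) using 1
      ring
  -- On `X u = 0` this is the single-equation problem for `N.erase u`; here a second element of `N`
  -- is needed.
  have e₁ : zeroClass k (insert (X u) (insert ((X u + s) * A + B) (stratum k (Z \ N) i)))
      ∈ tateSubring k := by
    have h := zeroClass_attach_mem (k := k) hi (he.trans hN) (hsub hA) (hsub hB) h₁ h₂ hne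
    rw [← hst] at h
    convert! h using 1
    refine zeroClass_congr ?_
    ext x
    simp only [PrimeSpectrum.mem_zeroLocus, Set.insert_subset_iff, SetLike.mem_coe]
    rw [and_left_comm]
    refine and_congr_left fun h => ?_
    change _ ↔ s * A + B ∈ x.asIdeal
    rw [add_mul, add_assoc]
    exact Submodule.add_mem_iff_right _ (x.asIdeal.mul_mem_right A h.1)
  have hcyl {W : Finset σ} (hW : (W : Set σ) ⊆ N) :
      zeroClass k (insert A (insert B (stratum k (Z \ W) i))) ∈ tateSubring k := by
    have h := zeroClass_union_stratum (k := k) hi (hW.trans hN) (S := {A, B})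
      (Set.insert_subset (supported_mono (Set.compl_subset_compl.mpr hW) hA)
        (Set.singleton_subset_iff.mpr (supported_mono (Set.compl_subset_compl.mpr hW) hB)))
    rw [Set.insert_union, Set.singleton_union, Set.insert_union, Set.singleton_union] at h
    exact h ▸ mul_mem (hpow _) h₂
  have hAB (T : Set (MvPolynomial σ k)) :
      zeroClass k (insert A (insert ((X u + s) * A + B) T)) = zeroClass k (insert A (insert B T)) := by
    refine zeroClass_congr ?_
    ext x
    simp only [PrimeSpectrum.mem_zeroLocus, Set.insert_subset_iff, SetLike.mem_coe]
    refine and_congr_right fun hx => and_congr_left fun _ => ?_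
    exact Submodule.add_mem_iff_right _ (x.asIdeal.mul_mem_left _ hx)
  have e₂ : zeroClass k (insert A (insert ((X u + s) * A + B) (stratum k (Z \ N) i)))
      ∈ tateSubring k := by
    rw [hAB]
    exact hcyl subset_rfl
  have e₃ : zeroClass k (insert (X u) (insert A
      (insert ((X u + s) * A + B) (stratum k (Z \ N) i)))) ∈ tateSubring k := by
    rw [Set.insert_comm, Set.insert_comm (X u), hst, hAB]
    exact hcyl he
  rw [e₀, eq_sub_of_add_eq key]
  exact sub_mem (add_mem e₁ e₂) e₃

end Attach

end GrothendieckRing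

/-! ### Sums over the maximal independent subsets -/

namespace IndependenceSystem

open Finset

variable {σ : Type*} [DecidableEq σ] {I : Finset σ → Prop}

open Classical in
/-- The maximal independent subsets of `E`, where `I` is the independence predicate. -/
def bases (I : Finset σ → Prop) (E : Finset σ) : Finset (Finset σ) :=
  E.powerset.filter fun S => Maximal (fun T => T ⊆ E ∧ I T) S

theorem mem_bases_iff (hI : ∀ S T, S ⊆ T → I T → I S) {E S : Finset σ} :
    S ∈ bases I E ↔ S ⊆ E ∧ I S ∧ ∀ g ∈ E, g ∉ S → ¬ I (insert g S) := by
  classical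
  rw [bases, mem_filter, mem_powerset]
  constructor
  · rintro ⟨hS, h⟩
    refine ⟨hS, h.prop.2, fun g hg hgS hi => hgS ?_⟩
    exact h.le_of_ge ⟨insert_subset hg hS, hi⟩ (subset_insert g S) (mem_insert_self g S)
  · rintro ⟨hS, hi, h⟩
    refine ⟨hS, ⟨hS, hi⟩, fun T hT hST g hg => ?_⟩
    by_contra hgS
    exact h g (hT.1 hg) hgS (hI _ T (insert_subset hg hST) hT.2)

/-- `N` is attached to `E` along `e`: the subsets of `N` other than `N` are independent from `E`,
while `N` can replace `e`. -/
structure IsAttached (I : Finset σ → Prop) (E N : Finset σ) (e : σ) : Prop where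
  mono : ∀ S T, S ⊆ T → I T → I S
  mem : e ∈ E
  disjoint : Disjoint E N
  indep_union_iff : ∀ T ⊆ E, ∀ M ⊆ N, M ≠ N → (I (T ∪ M) ↔ I T)
  indep_union_self_iff : ∀ T ⊆ E, I (T ∪ N) ↔ e ∉ T ∧ I (insert e T)

namespace IsAttached

variable {E N : Finset σ} {e : σ}

/-- A basis missing two elements of `N` could be enlarged by one of them, since all proper subsets
of `N` are harmless. If exactly one is missing, maximality is decided in `E`: restoring it would
amount to adding `e` to `T`. If none is missing, `N` plays the role of `e`. -/
theorem union_mem_bases_iff (h : IsAttached I E N e) {T M : Finset σ} (hT : T ⊆ E) (hM : M ⊆ N) :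
    T ∪ M ∈ bases I (E ∪ N) ↔
      (∃ f ∈ N, M = N.erase f ∧ T ∈ bases I E) ∨ (M = N ∧ e ∉ T ∧ insert e T ∈ bases I E) := by
  have hd {g : σ} (hg : g ∈ E) : g ∉ N := Finset.disjoint_left.mp h.disjoint hg
  rw [mem_bases_iff h.mono, mem_bases_iff h.mono, mem_bases_iff h.mono]
  constructor
  · rintro ⟨-, hi, hmax⟩
    by_cases hMN : M = N
    · subst hMN
      obtain ⟨heT, hie⟩ := (h.indep_union_self_iff T hT).mp hi
      refine Or.inr ⟨rfl, heT, insert_subset h.mem hT, hie, fun g hg hge hig => ?_⟩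
      rw [mem_insert, not_or] at hge
      refine hmax g (mem_union_left _ hg) (by simp [hge.2, hd hg]) ?_
      rw [← insert_union, h.indep_union_self_iff _ (insert_subset hg hT), Finset.insert_comm]
      exact ⟨by simp [heT, Ne.symm hge.1], hig⟩
    · obtain ⟨f, hf, hfM⟩ := exists_of_ssubset (hM.ssubset_of_ne hMN)
      have hiT := (h.indep_union_iff T hT M hM hMN).mp hi
      refine Or.inl ⟨f, hf, ?_, hT, hiT, fun g hg hgT hig => ?_⟩
      · refine Finset.Subset.antisymm (subset_erase.mpr ⟨hM, hfM⟩) fun g hg => ?_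
        obtain ⟨hgf, hgN⟩ := mem_erase.mp hg
        by_contra hgM
        refine hmax g (mem_union_right _ hgN)
          (by simpa [hgM] using fun hgT => hd (hT hgT) hgN) ?_
        rw [← union_insert, h.indep_union_iff T hT _ (insert_subset hgN hM)]
        · exact hiT
        · exact fun heq => (by simp [hgf.symm, hfM] : f ∉ insert g M) (heq ▸ hf)
      · refine hmax g (mem_union_left _ hg)
          (by simpa [hgT] using fun hgM => hd hg (hM hgM)) ?_
        rw [← insert_union, h.indep_union_iff _ (insert_subset hg hT) M hM hMN]
        exact hig
  · rintro (⟨f, hf, rfl, -, hi, hmax⟩ | ⟨rfl, heT, -, hi, hmax⟩)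
    · have hne : N.erase f ≠ N := (erase_ssubset hf).ne
      refine ⟨union_subset_union hT hM, (h.indep_union_iff T hT _ hM hne).mpr hi,
        fun g hg hgS hig => ?_⟩
      simp only [mem_union, mem_erase, not_or, not_and] at hgS
      rcases mem_union.mp hg with hgE | hgN
      · rw [← insert_union, h.indep_union_iff _ (insert_subset hgE hT) _ hM hne] at hig
        exact hmax g hgE hgS.1 hig
      · have hgf : g = f := by_contra fun hgf => hgS.2 hgf hgN
        rw [← union_insert, hgf, insert_erase hf, h.indep_union_self_iff T hT] at hig
        exact hmax e h.mem hig.1 hig.2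
    · refine ⟨union_subset_union hT hM, (h.indep_union_self_iff T hT).mpr ⟨heT, hi⟩,
        fun g hg hgS hig => ?_⟩
      simp only [mem_union, not_or] at hgS
      have hgE : g ∈ E := (mem_union.mp hg).resolve_right hgS.2
      rw [← insert_union, h.indep_union_self_iff _ (insert_subset hgE hT), Finset.insert_comm] at hig
      refine hmax g hgE ?_ hig.2
      rw [mem_insert, not_or]
      exact ⟨fun hge => hig.1 (hge ▸ mem_insert_self g T), hgS.1⟩

theorem sum_bases (h : IsAttached I E N e) {R : Type*} [AddCommMonoid R] (φ : Finset σ → R) :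
    ∑ S ∈ bases I (E ∪ N), φ S = ∑ f ∈ N, ∑ S ∈ bases I E, φ (S ∪ N.erase f)
      + ∑ S ∈ bases I E with e ∈ S, φ (S.erase e ∪ N) := by
  have hsub {S : Finset σ} (hS : S ∈ bases I E) : S ⊆ E := ((mem_bases_iff h.mono).mp hS).1
  have hd {g : σ} (hg : g ∈ E) : g ∉ N := Finset.disjoint_left.mp h.disjoint hg
  have hE {S M : Finset σ} (hS : S ⊆ E) (hM : M ⊆ N) : (S ∪ M) ∩ E = S := by
    ext g
    have := @hS g
    have := @hM g
    have := @hd g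
    simp only [mem_inter, mem_union]
    tauto
  have hN {S M : Finset σ} (hS : S ⊆ E) (hM : M ⊆ N) : (S ∪ M) ∩ N = M := by
    ext g
    have := @hS g
    have := @hM g
    have := @hd g
    simp only [mem_inter, mem_union]
    tauto
  have key : bases I (E ∪ N) =
      (N ×ˢ bases I E).image (fun p => p.2 ∪ N.erase p.1)
        ∪ ((bases I E).filter (e ∈ ·)).image (fun S => S.erase e ∪ N) := by
    ext S
    simp only [mem_union, mem_image, mem_product, mem_filter, Prod.exists]
    constructor
    · intro hS
      have hSE : S = (S ∩ E) ∪ (S ∩ N) := by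
        rw [← inter_union_distrib_left]
        exact (inter_eq_left.mpr ((mem_bases_iff h.mono).mp hS).1).symm
      rw [hSE, h.union_mem_bases_iff inter_subset_right inter_subset_right] at hS
      rcases hS with ⟨f, hf, hM, hT⟩ | ⟨hM, heT, hT⟩
      · exact Or.inl ⟨f, S ∩ E, ⟨hf, hT⟩, by rw [← hM, ← hSE]⟩
      · refine Or.inr ⟨insert e (S ∩ E), ⟨hT, mem_insert_self _ _⟩, ?_⟩
        rw [erase_insert heT]
        exact (congrArg (S ∩ E ∪ ·) hM).symm.trans hSE.symm
    · rintro (⟨f, T, ⟨hf, hT⟩, rfl⟩ | ⟨T, ⟨hT, heT⟩, rfl⟩)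
      · exact (h.union_mem_bases_iff (hsub hT) (erase_subset f N)).mpr (Or.inl ⟨f, hf, rfl, hT⟩)
      · refine (h.union_mem_bases_iff ((erase_subset e T).trans (hsub hT)) subset_rfl).mpr
          (Or.inr ⟨rfl, notMem_erase e T, ?_⟩)
        rwa [insert_erase heT]
  -- The two families are disjoint and injectively parametrized, because intersecting with `E` and
  -- `N` recovers the two parts of a basis.
  rw [key, sum_union, sum_image, sum_image, sum_product]
  · intro S hS T hT heq
    simp only [coe_filter, Set.mem_ofPred_eq] at hS hT
    have := congrArg (· ∩ E) heq
    simp only [hE ((erase_subset e S).trans (hsub hS.1)) subset_rfl,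
      hE ((erase_subset e T).trans (hsub hT.1)) subset_rfl] at this
    rw [← insert_erase hS.2, this, insert_erase hT.2]
  · rintro ⟨f, S⟩ hS ⟨g, T⟩ hT heq
    simp only [coe_product, Set.mem_prod, mem_coe] at hS hT
    have h₁ := congrArg (· ∩ E) heq
    have h₂ := congrArg (· ∩ N) heq
    simp only [hE (hsub hS.2) (erase_subset f N), hE (hsub hT.2) (erase_subset g N)] at h₁
    simp only [hN (hsub hS.2) (erase_subset f N), hN (hsub hT.2) (erase_subset g N)] at h₂
    have hfg : f = g := by
      by_contra hfg
      exact notMem_erase f N (h₂ ▸ mem_erase.mpr ⟨hfg, hS.1⟩)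
    rw [hfg, h₁]
  · rw [Finset.disjoint_left]
    intro S hS hS'
    simp only [mem_image, mem_product, mem_filter, Prod.exists] at hS hS'
    obtain ⟨f, T, ⟨hf, hT⟩, rfl⟩ := hS
    obtain ⟨T', ⟨hT', -⟩, heq⟩ := hS'
    have := congrArg (· ∩ N) heq
    simp only [hN ((erase_subset e T').trans (hsub hT')) subset_rfl,
      hN (hsub hT) (erase_subset f N)] at this
    exact notMem_erase f N (this ▸ hf)

end IsAttached

section BasisSum

variable {R : Type*} [CommRing R] (x : σ → R)

/-- The sum over the bases `S` of `E` of the product of the `x e`, `e ∈ E \ S`. -/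
def basisSum (I : Finset σ → Prop) (E : Finset σ) : R :=
  ∑ S ∈ bases I E, ∏ e ∈ E \ S, x e

/-- The part of `basisSum` given by the bases containing `u`. -/
def basisSumThrough (I : Finset σ → Prop) (E : Finset σ) (u : σ) : R :=
  ∑ S ∈ bases I E with u ∈ S, ∏ e ∈ E \ S, x e

variable {x} {E N : Finset σ} {e : σ}

theorem IsAttached.prod_sdiff_erase (h : IsAttached I E N e) {S : Finset σ} (hS : S ∈ bases I E)
    {f : σ} (hf : f ∈ N) :
    ∏ g ∈ (E ∪ N) \ (S ∪ N.erase f), x g = x f * ∏ g ∈ E \ S, x g := by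
  have hd {g : σ} (hg : g ∈ E) : g ∉ N := Finset.disjoint_left.mp h.disjoint hg
  have hSE : S ⊆ E := ((mem_bases_iff h.mono).mp hS).1
  rw [← prod_insert (fun hfE => hd (mem_sdiff.mp hfE).1 hf)]
  congr 1
  ext g
  have := @hSE g
  have := @hd g
  by_cases hgf : g = f
  · subst hgf
    simp only [mem_sdiff, mem_union, mem_erase, mem_insert]
    tauto
  · simp only [mem_sdiff, mem_union, mem_erase, mem_insert]
    tauto

theorem IsAttached.prod_sdiff_union (h : IsAttached I E N e) {S : Finset σ} (heS : e ∈ S) :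
    ∏ g ∈ (E ∪ N) \ (S.erase e ∪ N), x g = x e * ∏ g ∈ E \ S, x g := by
  have hd {g : σ} (hg : g ∈ E) : g ∉ N := Finset.disjoint_left.mp h.disjoint hg
  rw [← prod_insert (fun heE => (mem_sdiff.mp heE).2 heS)]
  congr 1
  ext g
  have := @hd g
  have := h.mem
  by_cases hge : g = e
  · subst hge
    simp only [mem_sdiff, mem_union, mem_erase, mem_insert]
    tauto
  · simp only [mem_sdiff, mem_union, mem_erase, mem_insert]
    tauto

/-- The complement of a basis gains the omitted `f ∈ N` in the first family of `sum_bases`, and the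
deleted `e` in the second. -/
theorem IsAttached.basisSum_eq (h : IsAttached I E N e) :
    basisSum x I (E ∪ N)
      = (∑ f ∈ N, x f) * basisSum x I E + x e * basisSumThrough x I E e := by
  rw [basisSum, h.sum_bases, basisSum, basisSumThrough, sum_mul, mul_sum]
  congr 1
  · refine sum_congr rfl fun f hf => ?_
    rw [mul_sum]
    exact sum_congr rfl fun S hS => h.prod_sdiff_erase hS hf
  · exact sum_congr rfl fun S hS => h.prod_sdiff_union (mem_filter.mp hS).2

/-- Compared with `basisSum_eq`, only the bases omitting `u` drop out; those containing all of `N`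
contain `u`. -/
theorem IsAttached.basisSumThrough_eq (h : IsAttached I E N e) {u : σ} (hu : u ∈ N) :
    basisSumThrough x I (E ∪ N) u
      = (∑ f ∈ N.erase u, x f) * basisSum x I E + x e * basisSumThrough x I E e := by
  have huE : u ∉ E := fun huE => Finset.disjoint_left.mp h.disjoint huE hu
  rw [basisSumThrough, sum_filter, h.sum_bases, basisSum, basisSumThrough, sum_mul, mul_sum]
  congr 1
  · rw [← add_sum_erase N _ hu, sum_eq_zero, zero_add]
    · refine sum_congr rfl fun f hf => ?_
      rw [mul_sum]
      refine sum_congr rfl fun S hS => ?_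
      rw [if_pos, h.prod_sdiff_erase hS (mem_of_mem_erase hf)]
      exact mem_union_right _ (mem_erase.mpr ⟨(ne_of_mem_erase hf).symm, hu⟩)
    · intro S hS
      refine if_neg fun huS => ?_
      rcases mem_union.mp huS with h' | h'
      · exact huE (((mem_bases_iff h.mono).mp hS).1 h')
      · exact notMem_erase u N h'
  · refine sum_congr rfl fun S hS => ?_
    rw [if_pos (mem_union_right _ hu), h.prod_sdiff_union (mem_filter.mp hS).2]

theorem bases_of_circuit {P : Finset σ} (h : ∀ T ⊆ P, I T ↔ T ≠ P)
    (hI : ∀ S T, S ⊆ T → I T → I S) : bases I P = P.image P.erase := by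
  ext S
  rw [mem_bases_iff hI, mem_image]
  constructor
  · rintro ⟨hS, hi, hmax⟩
    obtain ⟨f, hf, hfS⟩ := exists_of_ssubset (hS.ssubset_of_ne ((h S hS).mp hi))
    refine ⟨f, hf, ?_⟩
    have := (h _ (insert_subset hf hS)).not.mp (hmax f hf hfS)
    rw [← not_not.mp this, erase_insert hfS]
  · rintro ⟨f, hf, rfl⟩
    refine ⟨erase_subset f P, (h _ (erase_subset f P)).mpr
      (erase_ssubset hf).ne, fun g hg hgS hig => ?_⟩
    have hgf : g = f := by_contra fun hgf => hgS (mem_erase.mpr ⟨hgf, hg⟩)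
    rw [hgf, insert_erase hf] at hig
    exact (h P subset_rfl).mp hig rfl

theorem basisSum_of_circuit {P : Finset σ} (h : ∀ T ⊆ P, I T ↔ T ≠ P)
    (hI : ∀ S T, S ⊆ T → I T → I S) : basisSum x I P = ∑ f ∈ P, x f := by
  rw [basisSum, bases_of_circuit h hI, sum_image (erase_injOn P)]
  refine sum_congr rfl fun f hf => ?_
  rw [sdiff_erase hf, sdiff_self]
  simp

theorem basisSumThrough_of_circuit {P : Finset σ} (h : ∀ T ⊆ P, I T ↔ T ≠ P)
    (hI : ∀ S T, S ⊆ T → I T → I S) {u : σ} (hu : u ∈ P) :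
    basisSumThrough x I P u = ∑ f ∈ P.erase u, x f := by
  rw [basisSumThrough, bases_of_circuit h hI, sum_filter, sum_image (erase_injOn P),
    ← add_sum_erase P _ hu, if_neg (notMem_erase u P), zero_add]
  refine sum_congr rfl fun f hf => ?_
  rw [if_pos (mem_erase.mpr ⟨(ne_of_mem_erase hf).symm, hu⟩), sdiff_erase (mem_of_mem_erase hf),
    sdiff_self]
  simp

end BasisSum

end IndependenceSystem

/-! ### Attaching paths to graphs -/

namespace SimpleGraph

variable {V : Type*}

/-- The edges of the path through `q 0, q 1, …, q m`. -/
def pathEdges (q : ℕ → V) (m : ℕ) : Set (Sym2 V) := {e | ∃ i < m, s(q i, q (i + 1)) = e}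

theorem pathEdges_succ (q : ℕ → V) (m : ℕ) :
    pathEdges q (m + 1) = insert s(q m, q (m + 1)) (pathEdges q m) := by
  ext e
  simp only [pathEdges, Set.mem_ofPred_eq, Set.mem_insert_iff, Nat.lt_succ_iff_lt_or_eq]
  constructor
  · rintro ⟨i, hi | rfl, rfl⟩
    · exact Or.inr ⟨i, hi, rfl⟩
    · exact Or.inl rfl
  · rintro (rfl | ⟨i, hi, rfl⟩)
    · exact ⟨m, Or.inr rfl, rfl⟩
    · exact ⟨i, Or.inl hi, rfl⟩

theorem fromEdgeSet_insert (S : Set (Sym2 V)) (x y : V) :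
    fromEdgeSet (insert s(x, y) S) = fromEdgeSet S ⊔ edge x y := by
  rw [← Set.union_singleton, fromEdgeSet_union, edge]

theorem not_reachable_of_isolated {G : SimpleGraph V} {v w : V} (hv : ∀ u, ¬ G.Adj u v)
    (h : w ≠ v) : ¬ G.Reachable w v := by
  rintro ⟨p⟩
  cases p.reverse with
  | nil => exact h rfl
  | cons hadj _ => exact hv _ hadj.symm

theorem not_adj_fromEdgeSet {S : Set (Sym2 V)} {v : V} (hv : ∀ e ∈ S, v ∉ e) (u : V) :
    ¬ (fromEdgeSet S).Adj u v := fun h =>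
  hv _ ((fromEdgeSet_adj S).mp h).1 (Sym2.mem_mk_right u v)

theorem notMem_of_mem_pathEdges {q : ℕ → V} {m : ℕ} {v : V} (hv : ∀ i ≤ m, q i ≠ v) :
    ∀ e ∈ pathEdges q m, v ∉ e := by
  rintro _ ⟨i, hi, rfl⟩ h
  rcases Sym2.mem_iff.mp h with rfl | rfl
  · exact hv i hi.le rfl
  · exact hv (i + 1) hi rfl

/-- Attaching a path which has only its starting vertex in common with a forest gives a forest. -/
theorem isAcyclic_union_pathEdges {S : Set (Sym2 V)} {q : ℕ → V} {m : ℕ}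
    (hq : Set.InjOn q (Set.Iic m)) (hS : ∀ i, 1 ≤ i → i ≤ m → ∀ e ∈ S, q i ∉ e)
    (h : (fromEdgeSet S).IsAcyclic) : (fromEdgeSet (S ∪ pathEdges q m)).IsAcyclic := by
  induction m with
  | zero => simpa [pathEdges] using h
  | succ m ih =>
    rw [pathEdges_succ, Set.union_insert, fromEdgeSet_insert]
    refine IsAcyclic.sup_edge_of_not_reachable (not_reachable_of_isolated
      (not_adj_fromEdgeSet ?_) ?_) (ih (hq.mono (Set.Iic_subset_Iic.mpr m.le_succ))
        fun i hi him => hS i hi (him.trans m.le_succ))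
    · rintro e (he | he)
      · exact hS _ (Nat.le_add_left 1 m) le_rfl e he
      · refine notMem_of_mem_pathEdges (fun i hi heq => ?_) e he
        have := hq (Set.mem_Iic.mpr (hi.trans m.le_succ)) (Set.mem_Iic.mpr le_rfl) heq
        omega
    · intro heq
      have := hq (Set.mem_Iic.mpr m.le_succ) (Set.mem_Iic.mpr le_rfl) heq
      omega

/-- Contracting the attached path to its starting vertex maps walks in the enlarged graph to walks
in the original one. -/
theorem reachable_of_reachable_union_pathEdges {S : Set (Sym2 V)} {q : ℕ → V} {m : ℕ}
    (hS : ∀ i, 1 ≤ i → i ≤ m → ∀ e ∈ S, q i ∉ e) {x y : V}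
    (hx : ∀ i, 1 ≤ i → i ≤ m → q i ≠ x) (hy : ∀ i, 1 ≤ i → i ≤ m → q i ≠ y)
    (h : (fromEdgeSet (S ∪ pathEdges q m)).Reachable x y) : (fromEdgeSet S).Reachable x y := by
  classical
  let f : V → V := fun v => if ∃ i, 1 ≤ i ∧ i ≤ m ∧ q i = v then q 0 else v
  have hf {v : V} (hv : ∀ i, 1 ≤ i → i ≤ m → q i ≠ v) : f v = v :=
    if_neg fun ⟨i, h₁, h₂, h₃⟩ => hv i h₁ h₂ h₃
  have hfq {i : ℕ} (hi : i ≤ m) : f (q i) = q 0 := by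
    by_cases h₀ : 1 ≤ i
    · exact if_pos ⟨i, h₀, hi, rfl⟩
    · obtain rfl : i = 0 := by omega
      exact ite_self _
  rw [reachable_iff_reflTransGen] at h ⊢
  rw [← hf hx, ← hf hy]
  refine h.lift' f (fun a b hab => ?_)
  change Relation.ReflTransGen _ (f a) (f b)
  obtain ⟨hab, hne⟩ := (fromEdgeSet_adj _).mp hab
  rcases hab with hab | ⟨i, hi, hab⟩
  · rw [hf fun i h₁ h₂ heq => hS i h₁ h₂ _ hab (heq ▸ Sym2.mem_mk_left a b),
      hf fun i h₁ h₂ heq => hS i h₁ h₂ _ hab (heq ▸ Sym2.mem_mk_right a b)]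
    exact .single ((fromEdgeSet_adj S).mpr ⟨hab, hne⟩)
  · have : f a = q 0 ∧ f b = q 0 := by
      rcases Sym2.eq_iff.mp hab with ⟨rfl, rfl⟩ | ⟨rfl, rfl⟩
      · exact ⟨hfq hi.le, hfq hi⟩
      · exact ⟨hfq hi, hfq hi.le⟩
    rw [this.1, this.2]

theorem reachable_of_pathEdges_subset {S : Set (Sym2 V)} {q : ℕ → V} {m : ℕ}
    (h : pathEdges q m ⊆ S) : (fromEdgeSet S).Reachable (q 0) (q m) := by
  induction m with
  | zero => rfl
  | succ m ih =>
    rw [pathEdges_succ, Set.insert_subset_iff] at h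
    refine (ih h.2).trans ?_
    by_cases heq : q m = q (m + 1)
    · rw [heq]
    · exact (((fromEdgeSet_adj S).mpr ⟨h.1, heq⟩ : (fromEdgeSet S).Adj _ _)).reachable

/-- Deleting an edge of a path attached to a forest at both ends gives a forest. -/
theorem isAcyclic_union_of_ssubset_pathEdges {S M : Set (Sym2 V)} {q : ℕ → V} {m : ℕ}
    (hq : Set.InjOn q (Set.Iic m)) (hS : ∀ i, 1 ≤ i → i < m → ∀ e ∈ S, q i ∉ e)
    (h : (fromEdgeSet S).IsAcyclic) (hM : M ⊂ pathEdges q m) :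
    (fromEdgeSet (S ∪ M)).IsAcyclic := by
  obtain ⟨hsub, f, ⟨j, hj, rfl⟩, hfM⟩ := Set.ssubset_iff_exists.mp hM
  have hinj {a b : ℕ} (ha : a ≤ m) (hb : b ≤ m) (hab : q a = q b) : a = b := hq ha hb hab
  have h₁ : (fromEdgeSet (S ∪ pathEdges q j)).IsAcyclic :=
    isAcyclic_union_pathEdges (hq.mono (Set.Iic_subset_Iic.mpr hj.le))
      (fun i hi hij => hS i hi (hij.trans_lt hj)) h
  -- With edge `j` removed, the rest of the path consists of two dangling paths; the second is
  -- traversed backwards from `q m`, so that it too meets the earlier graph only in its starting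
  -- vertex.
  have h₂ : (fromEdgeSet (S ∪ pathEdges q j ∪
      pathEdges (fun i => q (m - i)) (m - (j + 1)))).IsAcyclic := by
    refine isAcyclic_union_pathEdges ?_ ?_ h₁
    · intro a ha b hb hab
      have ha : a ≤ m - (j + 1) := ha
      have hb : b ≤ m - (j + 1) := hb
      have := hinj (Nat.sub_le m a) (Nat.sub_le m b) hab
      omega
    · rintro i hi him e (he | he)
      · exact hS _ (by omega) (by omega) e he
      · refine notMem_of_mem_pathEdges (fun a ha heq => ?_) e he
        have := hinj (by omega) (by omega) heq
        omega
  refine h₂.anti (fromEdgeSet_mono ?_)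
  refine Set.union_subset (Set.subset_union_left.trans Set.subset_union_left) fun e he => ?_
  obtain ⟨i, hi, rfl⟩ := hsub he
  rcases lt_trichotomy i j with hij | rfl | hij
  · exact Or.inl (Or.inr ⟨i, hij, rfl⟩)
  · exact absurd he hfM
  · refine Or.inr ⟨m - (i + 1), by omega, ?_⟩
    rw [Sym2.eq_swap]
    dsimp only
    rw [show m - (m - (i + 1) + 1) = i by omega,
      show m - (m - (i + 1)) = i + 1 by omega]

/-- A path attached to a graph at both ends gives a forest if and only if an edge connecting the
two ends does so. -/
theorem isAcyclic_union_pathEdges_iff {S : Set (Sym2 V)} {q : ℕ → V} {m : ℕ} (hm : 2 ≤ m)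
    (hq : Set.InjOn q (Set.Iic m)) (hS : ∀ i, 1 ≤ i → i < m → ∀ e ∈ S, q i ∉ e) :
    (fromEdgeSet (S ∪ pathEdges q m)).IsAcyclic ↔
      s(q 0, q m) ∉ S ∧ (fromEdgeSet (insert s(q 0, q m) S)).IsAcyclic := by
  obtain ⟨n, rfl⟩ : ∃ n, m = n + 1 := ⟨m - 1, by omega⟩
  have hinj {a b : ℕ} (ha : a ≤ n + 1) (hb : b ≤ n + 1) (hab : q a = q b) : a = b := hq ha hb hab
  have hne : q 0 ≠ q (n + 1) := fun h => by have := hinj (by omega) (by omega) h; omega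
  have hne' : q n ≠ q (n + 1) := fun h => by have := hinj (by omega) (by omega) h; omega
  have hS' : ∀ i, 1 ≤ i → i ≤ n → ∀ e ∈ S, q i ∉ e := fun i h₁ h₂ => hS i h₁ (by omega)
  have hadj : ¬ (fromEdgeSet (S ∪ pathEdges q n)).Adj (q n) (q (n + 1)) := by
    intro h
    rcases ((fromEdgeSet_adj _).mp h).1 with h | h
    · exact hS' n (by omega) le_rfl _ h (Sym2.mem_mk_left _ _)
    · refine notMem_of_mem_pathEdges (fun i hi heq => ?_) _ h (Sym2.mem_mk_right _ _)
      have := hinj (by omega) (by omega) heq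
      omega
  -- All edges of the path but the last form a dangling path. The last edge closes a cycle exactly
  -- when the two ends were already connected in `S`.
  have hreach : (fromEdgeSet (S ∪ pathEdges q n)).Reachable (q n) (q (n + 1)) ↔
      (fromEdgeSet S).Reachable (q 0) (q (n + 1)) := by
    have h₀ : (fromEdgeSet (S ∪ pathEdges q n)).Reachable (q 0) (q n) :=
      reachable_of_pathEdges_subset Set.subset_union_right
    constructor
    · refine fun h => reachable_of_reachable_union_pathEdges hS' ?_ ?_ (h₀.trans h) <;>
      · intro i h₁ h₂ heq
        have := hinj (by omega) (by omega) heq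
        omega
    · exact fun h => h₀.symm.trans (h.mono (fromEdgeSet_mono Set.subset_union_left))
  rw [pathEdges_succ, Set.union_insert, fromEdgeSet_insert, isAcyclic_sup_fromEdgeSet_iff, hreach,
    fromEdgeSet_insert, isAcyclic_sup_fromEdgeSet_iff]
  simp only [hne, hne', hadj, false_or, or_false, fromEdgeSet_adj, ne_eq, not_false_eq_true,
    and_true]
  constructor
  · rintro ⟨h₁, h₂⟩
    refine ⟨fun h => h₂ ?_, h₁.anti (fromEdgeSet_mono Set.subset_union_left), fun h => (h₂ h).elim⟩
    exact (((fromEdgeSet_adj S).mpr ⟨h, hne⟩ : (fromEdgeSet S).Adj _ _)).reachable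
  · rintro ⟨h₁, h₂, h₃⟩
    refine ⟨isAcyclic_union_pathEdges (hq.mono (Set.Iic_subset_Iic.mpr n.le_succ)) hS' h₂,
      fun h => h₁ (h₃ h)⟩

end SimpleGraph

/-! ### Polygons and the independence system of forests. -/

namespace SimpleGraph

open IndependenceSystem

variable {V : Type*}

/-- The sets of edges of forests. -/
def IsForestSet (S : Finset (Sym2 V)) : Prop := (fromEdgeSet (S : Set (Sym2 V))).IsAcyclic

theorem IsForestSet.mono {S T : Finset (Sym2 V)} (hST : S ⊆ T) (hT : IsForestSet T) :
    IsForestSet S :=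
  IsAcyclic.anti (fromEdgeSet_mono (Finset.coe_subset.mpr hST)) hT

section Polygon

variable {r : ℕ} {p : ZMod r → V}

/-- The shift by one makes the path start at `p 1` and run round to `p r = p 0`, avoiding the side
between `p 0` and `p 1` along which the polygon is attached. -/
theorem injOn_polygon (hp : Function.Injective p) :
    Set.InjOn (fun i : ℕ => p ((i + 1 : ℕ) : ZMod r)) (Set.Iic (r - 1)) := by
  intro i hi j hj hij
  have hi : i ≤ r - 1 := hi
  have hj : j ≤ r - 1 := hj
  rcases Nat.eq_zero_or_pos r with rfl | hr
  · omega
  have h : ((i : ℕ) : ZMod r) = (j : ℕ) := by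
    have := hp hij
    push_cast at this
    exact add_right_cancel this
  have h' := congrArg ZMod.val h
  rwa [ZMod.val_natCast_of_lt (by omega), ZMod.val_natCast_of_lt (by omega)] at h'

theorem natCast_ne_zero_of_lt {a : ℕ} (h₀ : 0 < a) (h : a < r) : (a : ZMod r) ≠ 0 := by
  rw [Ne, ZMod.natCast_eq_zero_iff]
  exact Nat.not_dvd_of_pos_of_lt h₀ h

theorem pathEdges_polygon (hr : 3 ≤ r) (hp : Function.Injective p) :
    pathEdges (fun i : ℕ => p ((i + 1 : ℕ) : ZMod r)) (r - 1)
      = polygonSides p \ {s(p 0, p 1)} := by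
  have : NeZero r := ⟨by omega⟩
  ext e
  constructor
  · rintro ⟨i, hi, rfl⟩
    refine ⟨⟨((i + 1 : ℕ) : ZMod r), by push_cast; rfl⟩, fun h => ?_⟩
    rcases Sym2.eq_iff.mp (Set.mem_singleton_iff.mp h) with ⟨h₁, -⟩ | ⟨h₁, h₂⟩
    · exact natCast_ne_zero_of_lt (r := r) (a := i + 1) (by omega) (by omega) (hp h₁)
    -- The reversed side would force `2 = 0` in `ZMod r`; this is excluded by `3 ≤ r`.
    · have h₁ := hp h₁
      have h₂ := hp h₂
      push_cast at h₁ h₂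
      rw [h₁] at h₂
      exact natCast_ne_zero_of_lt (r := r) (a := 2) (by omega) (by omega)
        (by push_cast; rw [← h₂]; norm_num)
  · rintro ⟨⟨j, rfl⟩, hj⟩
    have hj₀ : j ≠ 0 := by
      rintro rfl
      exact hj (by simp)
    have hv : 0 < j.val := Nat.pos_of_ne_zero fun h => hj₀ ((ZMod.val_eq_zero j).mp h)
    have hlt := j.val_lt
    refine ⟨j.val - 1, by omega, ?_⟩
    dsimp only
    rw [Nat.sub_add_cancel hv, Nat.cast_add, ZMod.natCast_zmod_val, Nat.cast_one]

variable [DecidableEq V] {E N : Finset (Sym2 V)}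

theorem isAttached_polygon (hr : 3 ≤ r) (hp : Function.Injective p)
    (hN : (N : Set (Sym2 V)) = polygonSides p \ {s(p 0, p 1)}) (hside : s(p 0, p 1) ∈ E)
    (hnew : ∀ i, i ≠ 0 → i ≠ 1 → ∀ e ∈ E, p i ∉ e) :
    IsAttached IsForestSet E N s(p 0, p 1) := by
  have hinj := injOn_polygon (r := r) hp
  rw [← pathEdges_polygon hr hp] at hN
  set q : ℕ → V := fun i => p ((i + 1 : ℕ) : ZMod r) with hq
  have hq₀ : q 0 = p 1 := by simp [hq]
  have hqr : q (r - 1) = p 0 := by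
    change p ((r - 1 + 1 : ℕ) : ZMod r) = p 0
    rw [Nat.sub_add_cancel (by omega), ZMod.natCast_self]
  have he : s(p 0, p 1) = s(q 0, q (r - 1)) := by rw [hq₀, hqr, Sym2.eq_swap]
  have hnew' : ∀ i, 1 ≤ i → i < r - 1 → ∀ e ∈ E, q i ∉ e := by
    refine fun i h₁ h₂ => hnew _ (natCast_ne_zero_of_lt (by omega) (by omega)) fun h => ?_
    refine natCast_ne_zero_of_lt (r := r) (a := i) (by omega) (by omega) ?_
    push_cast at h
    exact add_eq_right.mp h
  refine ⟨fun S T => IsForestSet.mono, hside, ?_, fun T hT M hM hMN => ?_, fun T hT => ?_⟩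
  · rw [Finset.disjoint_left]
    intro e heE heN
    obtain ⟨i, hi, rfl⟩ : e ∈ pathEdges q (r - 1) := hN ▸ heN
    rcases Nat.eq_zero_or_pos i with rfl | hi₀
    · exact hnew' 1 le_rfl (by omega) _ heE (Sym2.mem_mk_right _ _)
    · exact hnew' i hi₀ hi _ heE (Sym2.mem_mk_left _ _)
  · refine ⟨IsForestSet.mono Finset.subset_union_left, fun h => ?_⟩
    rw [IsForestSet, Finset.coe_union]
    refine isAcyclic_union_of_ssubset_pathEdges hinj
      (fun i h₁ h₂ e he => hnew' i h₁ h₂ e (hT he)) h ?_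
    rw [← hN]
    exact Finset.coe_ssubset.mpr (hM.ssubset_of_ne hMN)
  · rw [IsForestSet, IsForestSet, Finset.coe_union, hN, Finset.coe_insert, he,
      isAcyclic_union_pathEdges_iff (by omega) hinj
        (fun i h₁ h₂ e he => hnew' i h₁ h₂ e (hT he)), Finset.mem_coe]

/-- A polygon with at least three sides contributes two distinct new edges, so one remains after
discarding the next side of attachment. -/
theorem nontrivial_polygon (hr : 3 ≤ r) (hp : Function.Injective p)
    (hN : (N : Set (Sym2 V)) = polygonSides p \ {s(p 0, p 1)}) (u : Sym2 V) :
    (N.erase u).Nonempty := by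
  have hinj := injOn_polygon (r := r) hp
  rw [← pathEdges_polygon hr hp] at hN
  set q : ℕ → V := fun i => p ((i + 1 : ℕ) : ZMod r) with hq
  have h₀ : s(q 0, q 1) ∈ N := by
    rw [← Finset.mem_coe, hN]
    exact ⟨0, by omega, rfl⟩
  have h₁ : s(q 1, q 2) ∈ N := by
    rw [← Finset.mem_coe, hN]
    exact ⟨1, by omega, rfl⟩
  have hne : s(q 0, q 1) ≠ s(q 1, q 2) := by
    intro h
    rcases Sym2.eq_iff.mp h with ⟨h, -⟩ | ⟨h, -⟩
    · have := hinj (show 0 ≤ r - 1 by omega) (show 1 ≤ r - 1 by omega) h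
      omega
    · have := hinj (show 0 ≤ r - 1 by omega) (show 2 ≤ r - 1 by omega) h
      omega
  by_cases hu : s(q 0, q 1) = u
  · exact ⟨_, Finset.mem_erase.mpr ⟨fun h => hne (hu.trans h.symm), h₁⟩⟩
  · exact ⟨_, Finset.mem_erase.mpr ⟨hu, h₀⟩⟩

/-- The only set of sides of a polygon that is not a forest is the set of all sides. -/
theorem isForestSet_iff_ne_polygon (hr : 3 ≤ r) (hp : Function.Injective p) {P : Finset (Sym2 V)}
    (hP : (P : Set (Sym2 V)) = polygonSides p) {T : Finset (Sym2 V)} (hT : T ⊆ P) :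
    IsForestSet T ↔ T ≠ P := by
  set e : Sym2 V := s(p 0, p 1) with he
  have heP : e ∈ P := by
    rw [← Finset.mem_coe, hP]
    exact ⟨0, by simp [he]⟩
  have : Fact (1 < r) := ⟨by omega⟩
  have hne : p 0 ≠ p 1 := fun h => zero_ne_one (hp h)
  -- A polygon is a path attached to the graph with the single edge `e`.
  have h : IsAttached IsForestSet {e} (P.erase e) e := isAttached_polygon hr hp
    (by rw [Finset.coe_erase, hP]) (Finset.mem_singleton_self e) (by
      intro i h₀ h₁ e' he' hi
      rw [Finset.mem_singleton.mp he'] at hi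
      rcases Sym2.mem_iff.mp hi with hi | hi
      · exact h₀ (hp hi)
      · exact h₁ (hp hi))
  have hsingle : IsForestSet {e} := by
    rw [IsForestSet, Finset.coe_singleton, ← insert_empty_eq, he, fromEdgeSet_insert,
      fromEdgeSet_empty, isAcyclic_sup_fromEdgeSet_iff]
    exact ⟨isAcyclic_bot, fun h => Or.inl (by simpa using h)⟩
  have hT' : T = (T ∩ {e}) ∪ (T ∩ P.erase e) := by
    ext g
    have := @hT g
    simp only [Finset.mem_union, Finset.mem_inter, Finset.mem_singleton, Finset.mem_erase]
    tauto
  by_cases hTN : T ∩ P.erase e = P.erase e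
  · rw [hT', hTN, h.indep_union_self_iff _ Finset.inter_subset_right]
    by_cases heT : e ∈ T
    · simp [heT, Finset.insert_erase heP]
    · have : insert e (T ∩ {e}) = {e} := by simp [heT]
      rw [this]
      simp only [Finset.mem_inter, heT, false_and, not_false_eq_true, hsingle, and_self, true_iff]
      intro h
      have heP' : e ∈ T ∩ {e} ∪ P.erase e := by
        rw [h]
        exact heP
      simp [heT] at heP'
  · rw [hT', h.indep_union_iff _ Finset.inter_subset_right _ Finset.inter_subset_right hTN, ← hT']
    refine ⟨?_, fun _ => hsingle.mono Finset.inter_subset_right⟩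
    rintro - rfl
    exact hTN (Finset.inter_eq_right.mpr (Finset.erase_subset e T))

end Polygon

end SimpleGraph

namespace MvPolynomial

theorem isHomogeneous_sum_X {k σ : Type*} [CommSemiring k] (N : Finset σ) :
    (∑ f ∈ N, X f : MvPolynomial σ k).IsHomogeneous 1 :=
  IsHomogeneous.sum _ _ _ fun f _ => isHomogeneous_X k f

end MvPolynomial

namespace IndependenceSystem

open MvPolynomial

variable {k : Type*} [Field k] {σ : Type*} [DecidableEq σ] (I : Finset σ → Prop)

theorem basisSum_mem_supported (E : Finset σ) :
    basisSum (X : σ → MvPolynomial σ k) I E ∈ supported k (E : Set σ) :=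
  sum_mem fun _ _ => prod_mem fun _ he => X_mem_supported.mpr (Finset.mem_sdiff.mp he).1

theorem basisSumThrough_mem_supported (E : Finset σ) (u : σ) :
    basisSumThrough (X : σ → MvPolynomial σ k) I E u ∈ supported k (E : Set σ) :=
  sum_mem fun _ _ => prod_mem fun _ he => X_mem_supported.mpr (Finset.mem_sdiff.mp he).1

end IndependenceSystem

/-! ### Induction along the chain of polygons. -/

namespace SimpleGraph

open MvPolynomial GrothendieckRing IndependenceSystem

variable {V : Type u} [Finite V] [DecidableEq V]

/-- The properties of the Kirchhoff polynomial of the graph with edges `E` that are stable under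
attaching a polygon along an edge in `F`; here `P` are the edges of the first polygon. -/
structure IsTame (k : Type u) [Field k] (E F P : Finset (Sym2 V)) : Prop where
  free_subset : F ⊆ E
  first_subset : P ⊆ E
  basisSum_mem_span : basisSum (X : _ → MvPolynomial (Sym2 V) k) IsForestSet E
    ∈ Ideal.span (X '' (P : Set (Sym2 V)))
  mul_basisSumThrough_mem_span : ∀ u ∈ F,
    X u * basisSumThrough (X : _ → MvPolynomial (Sym2 V) k) IsForestSet E u
      ∈ Ideal.span (X '' (P : Set (Sym2 V)))
  isHomogeneous : ∃ d, 0 < d ∧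
    (basisSum (X : _ → MvPolynomial (Sym2 V) k) IsForestSet E).IsHomogeneous d ∧
    ∀ u ∈ F, (basisSumThrough (X : _ → MvPolynomial (Sym2 V) k) IsForestSet E u).IsHomogeneous d
  zeroClass_mem : ∀ Z ⊆ P, ∀ i ∈ P, i ∉ Z →
    zeroClass k (insert (basisSum X IsForestSet E)
      (stratum k ((E : Set (Sym2 V))ᶜ ∪ Z) i)) ∈ tateSubring k
  zeroClass_pair_mem : ∀ Z ⊆ P, ∀ i ∈ P, i ∉ Z → ∀ u ∈ F,
    zeroClass k (insert (basisSum X IsForestSet E)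
      (insert (X u * basisSumThrough X IsForestSet E u)
        (stratum k ((E : Set (Sym2 V))ᶜ ∪ Z) i))) ∈ tateSubring k

variable {k : Type u} [Field k]

/-- For one polygon the polynomial is `∑ f ∈ P, X f`, and the part through `u` is this sum without
`X u`. Where the full sum vanishes, the product of `X u` with that part vanishes exactly when `X u`
does, so the pair condition is again about a linear form on a stratum. -/
theorem isTame_polygon {r : ℕ} (hr : 3 ≤ r) {p : ZMod r → V} (hp : Function.Injective p)
    {P : Finset (Sym2 V)} (hP : (P : Set (Sym2 V)) = polygonSides p) : IsTame k P P P := by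
  have hc : ∀ T ⊆ P, IsForestSet T ↔ T ≠ P := fun T hT => isForestSet_iff_ne_polygon hr hp hP hT
  have hI : ∀ S T : Finset (Sym2 V), S ⊆ T → IsForestSet T → IsForestSet S :=
    fun S T => IsForestSet.mono
  have hsum : basisSum (X : _ → MvPolynomial (Sym2 V) k) IsForestSet P = ∑ f ∈ P, X f :=
    basisSum_of_circuit hc hI
  have hthrough {u : Sym2 V} (hu : u ∈ P) :
      basisSumThrough (X : _ → MvPolynomial (Sym2 V) k) IsForestSet P u = ∑ f ∈ P.erase u, X f :=
    basisSumThrough_of_circuit hc hI hu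
  have hiZ {Z : Finset (Sym2 V)} {i : Sym2 V} (hi : i ∈ P) (hZ : i ∉ Z) :
      i ∉ (P : Set (Sym2 V))ᶜ ∪ Z := by simp [hi, hZ]
  refine ⟨subset_rfl, subset_rfl, ?_, fun u hu => ?_, ⟨1, one_pos, ?_, fun u hu => ?_⟩,
    fun Z hZP i hi hiZ' => ?_, fun Z hZP i hi hiZ' u hu => ?_⟩
  · rw [hsum]
    exact sum_mem fun f hf => Ideal.subset_span ⟨f, hf, rfl⟩
  · exact Ideal.mul_mem_right _ _ (Ideal.subset_span ⟨u, hu, rfl⟩)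
  · rw [hsum]
    exact isHomogeneous_sum_X P
  · rw [hthrough hu]
    exact isHomogeneous_sum_X _
  · rw [hsum]
    exact zeroClass_sum_stratum_mem (hiZ hi hiZ') hi
  · rw [hsum, hthrough hu]
    have key : zeroClass k (insert (∑ f ∈ P, X f) (insert (X u * ∑ f ∈ P.erase u, X f)
          (stratum k ((P : Set (Sym2 V))ᶜ ∪ Z) i)))
        = zeroClass k (insert (∑ f ∈ P, X f) (insert (X u)
          (stratum k ((P : Set (Sym2 V))ᶜ ∪ Z) i))) := by
      refine zeroClass_congr ?_
      ext x
      simp only [PrimeSpectrum.mem_zeroLocus, Set.insert_subset_iff, SetLike.mem_coe]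
      refine and_congr_right fun hx => and_congr_left fun _ => ?_
      refine ⟨fun h => ?_, fun h => x.asIdeal.mul_mem_right _ h⟩
      rcases x.2.mem_or_mem h with h | h
      · exact h
      · rw [← Finset.add_sum_erase P X hu] at hx
        exact (Submodule.add_mem_iff_left _ h).mp hx
    rw [key]
    -- If `u` is the normalized coordinate, the equations `X u = 0` and `X i = 1` contradict each
    -- other.
    by_cases hui : u = i
    · rw [zeroClass_eq_zero]
      · exact zero_mem _
      · have h₁ : (X i : MvPolynomial (Sym2 V) k) ∈ Ideal.span (insert (∑ f ∈ P, X f) (insert (X u)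
            (stratum k ((P : Set (Sym2 V))ᶜ ∪ Z) i))) :=
          Ideal.subset_span (Set.mem_insert_of_mem _ (Set.mem_insert_iff.mpr (Or.inl (hui ▸ rfl))))
        have h₂ : (X i - 1 : MvPolynomial (Sym2 V) k) ∈ Ideal.span (insert (∑ f ∈ P, X f)
            (insert (X u) (stratum k ((P : Set (Sym2 V))ᶜ ∪ Z) i))) :=
          Ideal.subset_span (Set.mem_insert_of_mem _ (Set.mem_insert_of_mem _ (Set.mem_insert _ _)))
        simpa using sub_mem h₁ h₂
    · rw [← stratum_insert]
      exact zeroClass_sum_stratum_mem (by simp [hi, hiZ', Ne.symm hui]) hi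

theorem IsTame.attach {E F P N : Finset (Sym2 V)} (hE : IsTame k E F P) {e : Sym2 V} (he : e ∈ F)
    (h : IsAttached IsForestSet E N e) (hN : ∀ u, (N.erase u).Nonempty) :
    IsTame k (E ∪ N) N P := by
  set A := basisSum (X : _ → MvPolynomial (Sym2 V) k) IsForestSet E with hA
  set B := X e * basisSumThrough (X : _ → MvPolynomial (Sym2 V) k) IsForestSet E e with hB
  have hsum : basisSum (X : _ → MvPolynomial (Sym2 V) k) IsForestSet (E ∪ N)
      = (∑ f ∈ N, X f) * A + B := h.basisSum_eq
  have hthrough {u : Sym2 V} (hu : u ∈ N) :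
      basisSumThrough (X : _ → MvPolynomial (Sym2 V) k) IsForestSet (E ∪ N) u
        = (∑ f ∈ N.erase u, X f) * A + B := h.basisSumThrough_eq hu
  have hEN : (E : Set (Sym2 V)) ⊆ (N : Set (Sym2 V))ᶜ :=
    fun g hg hgN => Finset.disjoint_left.mp h.disjoint hg hgN
  have hAs : A ∈ supported k (N : Set (Sym2 V))ᶜ :=
    supported_mono hEN (basisSum_mem_supported _ _)
  have hBs : B ∈ supported k (N : Set (Sym2 V))ᶜ :=
    supported_mono hEN (mul_mem (X_mem_supported.mpr h.mem) (basisSumThrough_mem_supported _ _ _))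
  have hspan (s : MvPolynomial (Sym2 V) k) :
      s * A + B ∈ Ideal.span (X '' (P : Set (Sym2 V)) : Set (MvPolynomial (Sym2 V) k)) :=
    add_mem (Ideal.mul_mem_left _ _ hE.basisSum_mem_span) (hE.mul_basisSumThrough_mem_span e he)
  obtain ⟨d, hd, hAd, hBd⟩ := hE.isHomogeneous
  have hhom (M : Finset (Sym2 V)) : ((∑ f ∈ M, X f) * A + B).IsHomogeneous (1 + d) :=
    ((isHomogeneous_sum_X M).mul hAd).add ((isHomogeneous_X k e).mul (hBd e he))
  -- Variables that are not edges are set to `0`, so adding the edges `N` to the graph means freeing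
  -- the variables in `N`; `Z` is not affected, as it lies in the first polygon.
  have hZ {Z : Finset (Sym2 V)} (hZP : Z ⊆ P) :
      (((E ∪ N : Finset (Sym2 V)) : Set (Sym2 V))ᶜ ∪ Z)
        = ((E : Set (Sym2 V))ᶜ ∪ Z) \ (N : Set (Sym2 V)) := by
    ext g
    have h₁ := @hEN g
    have h₂ : g ∈ Z → g ∈ E := fun hg => hE.first_subset (hZP hg)
    simp only [Finset.coe_union, Set.mem_union, Set.mem_compl_iff, Set.mem_sdiff,
      Finset.mem_coe] at h₁ ⊢
    tauto
  have hNZ (Z : Finset (Sym2 V)) : (N : Set (Sym2 V)) ⊆ (E : Set (Sym2 V))ᶜ ∪ Z :=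
    fun g hg => Or.inl fun hgE => hEN hgE hg
  have hiZ {Z : Finset (Sym2 V)} {i : Sym2 V} (hi : i ∈ P) (hZ : i ∉ Z) :
      i ∉ (E : Set (Sym2 V))ᶜ ∪ Z := by simp [hE.first_subset hi, hZ]
  refine ⟨Finset.subset_union_right, hE.first_subset.trans Finset.subset_union_left, ?_,
    fun u hu => ?_, ⟨1 + d, by omega, ?_, fun u hu => ?_⟩,
    fun Z hZP i hi hiZ' => ?_, fun Z hZP i hi hiZ' u hu => ?_⟩
  · exact hsum ▸ hspan _
  · exact hthrough hu ▸ Ideal.mul_mem_left _ _ (hspan _)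
  · exact hsum ▸ hhom N
  · exact hthrough hu ▸ hhom _
  · rw [hsum, hZ hZP]
    exact zeroClass_attach_mem (hiZ hi hiZ') (hNZ Z) hAs hBs (hE.zeroClass_mem Z hZP i hi hiZ')
      (hE.zeroClass_pair_mem Z hZP i hi hiZ' e he) ((hN e).mono (Finset.erase_subset e N))
  · rw [hsum, hthrough hu, hZ hZP]
    exact zeroClass_attach_pair_mem (hiZ hi hiZ') (hNZ Z) hAs hBs
      (hE.zeroClass_mem Z hZP i hi hiZ') (hE.zeroClass_pair_mem Z hZP i hi hiZ' e he) hu (hN u)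

theorem PolygonChain.exists_isTame {E F : Set (Sym2 V)} (h : PolygonChain E F) :
    ∃ E' F' P : Finset (Sym2 V), (E' : Set (Sym2 V)) = E ∧ (F' : Set (Sym2 V)) = F ∧
      IsTame k E' F' P := by
  induction h with
  | polygon hr p hp =>
    have hfin := Set.toFinite (polygonSides p)
    exact ⟨hfin.toFinset, hfin.toFinset, hfin.toFinset, hfin.coe_toFinset, hfin.coe_toFinset,
      isTame_polygon hr hp hfin.coe_toFinset⟩
  | attach hE hr p hp hside hnew ih =>
    obtain ⟨E', F', P, rfl, rfl, hT⟩ := ih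
    have hfin := Set.toFinite (polygonSides p \ {s(p 0, p 1)})
    refine ⟨E' ∪ hfin.toFinset, hfin.toFinset, P, ?_, hfin.coe_toFinset,
      hT.attach hside (isAttached_polygon hr hp hfin.coe_toFinset (hT.free_subset hside) hnew)
        (nontrivial_polygon hr hp hfin.coe_toFinset)⟩
    rw [Finset.coe_union, hfin.coe_toFinset]
    ext g
    -- The side of attachment already belongs to `E'`, so it does not matter whether it is added
    -- again.
    by_cases hg : g = s(p 0, p 1)
    · have := hT.free_subset hside
      simp [hg, this]
    · simp [hg]

end SimpleGraph

/-! ### Passing between all pairs of vertices and the edges of the graph as variables. -/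

namespace GrothendieckRing

open MvPolynomial

variable {k : Type u} [Field k] {σ : Type u}

theorem killCompl_X_of_notMem {s : Set σ} {i : σ} (hi : i ∉ s) :
    killCompl (R := k) (Subtype.val_injective : Function.Injective ((↑) : s → σ)) (X i) = 0 := by
  rw [killCompl, aeval_X, dif_neg (by simpa using hi)]

/-- Modulo the variables outside `s`, killing them and renaming back is the identity, as can be
checked on variables. -/
theorem ker_killCompl_le (s : Set σ) :
    RingHom.ker (killCompl (R := k) (Subtype.val_injective : Function.Injective ((↑) : s → σ)))
      ≤ Ideal.span (X '' sᶜ) := by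
  intro p hp
  have h : ((Ideal.Quotient.mkₐ k (Ideal.span (X '' sᶜ))).comp (rename ((↑) : s → σ))).comp
      (killCompl (Subtype.val_injective : Function.Injective ((↑) : s → σ)))
      = Ideal.Quotient.mkₐ k (Ideal.span (X '' sᶜ : Set (MvPolynomial σ k))) := by
    refine algHom_ext fun i => ?_
    by_cases hi : i ∈ s
    · have : (X i : MvPolynomial σ k) = rename ((↑) : s → σ) (X ⟨i, hi⟩) :=
        (rename_X (R := k) ((↑) : s → σ) ⟨i, hi⟩).symm
      rw [this, AlgHom.comp_apply, killCompl_rename_app, AlgHom.comp_apply]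
    · rw [AlgHom.comp_apply, killCompl_X_of_notMem hi, map_zero, eq_comm]
      exact Ideal.Quotient.eq_zero_iff_mem.mpr (Ideal.subset_span ⟨i, hi, rfl⟩)
  refine Ideal.Quotient.eq_zero_iff_mem.mp ?_
  have := DFunLike.congr_fun h p
  rw [AlgHom.comp_apply, (RingHom.mem_ker).mp hp, map_zero] at this
  exact this.symm

theorem zeroClass_insert_rename [Finite σ] {s : Set σ} (f : MvPolynomial s k) (W : Set s) (i : s) :
    zeroClass k (insert (rename (↑) f) (stratum k (sᶜ ∪ (↑) '' W) (i : σ)))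
      = zeroClass k (insert f (stratum k W i)) := by
  have hinj : Function.Injective ((↑) : s → σ) := Subtype.val_injective
  have hX (j : s) : killCompl (R := k) hinj (X (j : σ)) = X j := by
    rw [← rename_X ((↑) : s → σ) j, killCompl_rename_app]
  rw [← zeroClass_of_surjective (killCompl hinj)
    (Function.LeftInverse.surjective (killCompl_rename_app hinj))
    ((ker_killCompl_le s).trans (Ideal.span_mono ?_))]
  · refine zeroClass_congr_span ?_
    rw [Set.image_insert_eq, killCompl_rename_app, stratum, stratum, Set.image_insert_eq, map_sub,
      hX, map_one, Set.image_union, Set.image_union]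
    have h₁ : killCompl (R := k) hinj '' (X '' ((↑) '' W)) = X '' W := by
      simp only [Set.image_image, hX]
    rw [h₁, ← Set.union_insert, ← Set.union_insert, Ideal.span_union, sup_eq_right, Ideal.span_le]
    rintro _ ⟨_, ⟨j, hj, rfl⟩, rfl⟩
    rw [killCompl_X_of_notMem hj]
    exact zero_mem _
  · rw [stratum, Set.image_union]
    exact fun p hp => Set.mem_insert_of_mem _ (Set.mem_insert_of_mem _ (Or.inl hp))

end GrothendieckRing

/-! ### Stratification of a projective hypersurface. -/

namespace ProjectiveHypersurface

open MvPolynomial GrothendieckRing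

variable {k : Type u} [Field k] {σ : Type u} [Finite σ] {f : MvPolynomial σ k} {d : ℕ}

/-- Cutting by coordinate hyperplanes one at a time. -/
theorem projClass_sub_mem (hd : 0 < d) (hf : f.IsHomogeneous d) {W₀ W : Finset σ}
    (h : ∀ Z ⊆ W, ∀ i ∈ W, i ∉ Z → i ∉ W₀ →
      zeroClass k (insert f (stratum k ((W₀ : Set σ) ∪ Z) i)) ∈ tateSubring k) :
    projClass (insert f (X '' (W₀ : Set σ)))
      - projClass (insert f (X '' ((W₀ : Set σ) ∪ W))) ∈ tateSubring k := by
  classical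
  induction W using Finset.induction_on with
  | empty => simp
  | insert i W hi ih =>
    specialize ih fun Z hZ j hj => h Z (hZ.trans (Finset.subset_insert i W)) j
      (Finset.mem_insert_of_mem hj)
    rw [Finset.coe_insert, Set.union_insert]
    by_cases hiW : i ∈ W₀
    · rwa [Set.insert_eq_of_mem (Set.mem_union_left _ hiW)]
    have hS : ∀ p ∈ insert f (X '' ((W₀ : Set σ) ∪ W)), ∃ n, 0 < n ∧ p.IsHomogeneous n := by
      rintro _ (rfl | ⟨j, -, rfl⟩)
      · exact ⟨d, hd, hf⟩
      · exact ⟨1, one_pos, isHomogeneous_X k j⟩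
    have key := projClass_eq_add hS i
    rw [Set.insert_comm, Set.insert_comm (X i - 1), ← Set.image_insert_eq, ← stratum] at key
    rw [key] at ih
    have := add_mem ih
      (h W (Finset.subset_insert i W) i (Finset.mem_insert_self i W) hi hiW)
    convert this using 1
    ring

/-- The class of a hypersurface through a coordinate linear subspace lies in the Tate subring if the
strata of its complement do. -/
theorem cls_hypersurfaceVar_mem (hd : 0 < d) (hf : f.IsHomogeneous d) {P : Finset σ}
    (hP : f ∈ Ideal.span (X '' (P : Set σ)))
    (h : ∀ Z ⊆ P, ∀ i ∈ P, i ∉ Z →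
      zeroClass k (insert f (stratum k (Z : Set σ) i)) ∈ tateSubring k) :
    cls (hypersurfaceVar f) ∈ tateSubring k := by
  have := Fintype.ofFinite σ
  have h₁ := projClass_sub_mem hd hf (W₀ := ∅) (W := P) (by simpa using h)
  -- Once the coordinates in `P` vanish, so does `f`; the remaining strata are affine spaces, and
  -- nothing is left after all coordinates have been cut.
  have h₂ := projClass_sub_mem hd hf (W₀ := P) (W := Finset.univ) (by
    intro Z _ i _ hiZ hiP
    have : zeroClass k (insert f (stratum k ((P : Set σ) ∪ Z) i))
        = zeroClass k (stratum k ((P : Set σ) ∪ Z) i) := by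
      refine zeroClass_congr_span ?_
      rw [Ideal.span_insert, sup_eq_right, Ideal.span_singleton_le_iff_mem]
      refine Ideal.span_mono ?_ hP
      exact (Set.image_mono Set.subset_union_left).trans (Set.subset_insert _ _)
    rw [this]
    exact zeroClass_stratum_mem (by simp [hiZ, hiP]))
  rw [Finset.coe_univ, Set.union_univ, projClass_eq_zero (S := insert f (X '' Set.univ))
    (fun i => Set.mem_insert_of_mem _ ⟨i, trivial, rfl⟩), sub_zero] at h₂
  rw [Finset.coe_empty, Set.empty_union, Set.image_empty, insert_empty_eq] at h₁
  rw [cls_hypersurfaceVar]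
  simpa using add_mem h₁ h₂

end ProjectiveHypersurface

/-! ### The Kirchhoff polynomial as a sum over bases, and the conclusion. -/

namespace SimpleGraph

open MvPolynomial GrothendieckRing IndependenceSystem

variable {V : Type u} {Γ : SimpleGraph V} {k : Type u} [Field k]

theorem edgeSet_fromEdgeSet_of_subset {S : Set (Sym2 V)} (hS : S ⊆ Γ.edgeSet) :
    (fromEdgeSet S).edgeSet = S := by
  rw [edgeSet_fromEdgeSet, sdiff_eq_left, Set.disjoint_left]
  exact fun e he => Γ.not_isDiag_of_mem_edgeSet (hS he)

variable [Fintype V]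

theorem maximal_isForestSet_iff {E : Finset (Sym2 V)} (hE : (E : Set (Sym2 V)) = Γ.edgeSet)
    {T : SimpleGraph V} {M : Finset (Sym2 V)} (hM : (M : Set (Sym2 V)) = T.edgeSet) :
    Maximal (fun S => S ⊆ E ∧ IsForestSet S) M
      ↔ Maximal (fun H => H ≤ Γ ∧ H.IsAcyclic) T := by
  have h (H : SimpleGraph V) (S : Finset (Sym2 V)) (hS : (S : Set (Sym2 V)) = H.edgeSet) :
      (S ⊆ E ∧ IsForestSet S) ↔ (H ≤ Γ ∧ H.IsAcyclic) := by
    rw [← Finset.coe_subset, hE, IsForestSet, hS, fromEdgeSet_edgeSet, edgeSet_subset_edgeSet]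
  refine ⟨fun hT => ⟨(h T M hM).mp hT.1, fun H hH hTH => ?_⟩,
    fun hT => ⟨(h T M hM).mpr hT.1, fun S hS hTS => ?_⟩⟩
  · have hH' := (Set.toFinite H.edgeSet).coe_toFinset
    rw [← edgeSet_subset_edgeSet, ← hM, ← hH', Finset.coe_subset] at hTH ⊢
    exact hT.2 ((h H _ hH').mpr hH) hTH
  · have hS' := edgeSet_fromEdgeSet_of_subset (hE.le.trans' (Finset.coe_subset.mpr hS.1))
    rw [← Finset.coe_subset, hM, ← hS', edgeSet_subset_edgeSet] at hTS ⊢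
    exact hT.2 ((h _ S hS'.symm).mp hS) hTS

-- Renaming places the polynomial in the ring with variables `Sym2 V`, which is common to all graphs
-- occurring along the chain.
open Classical in
theorem rename_kirchhoffPolynomial {E : Finset (Sym2 V)} (hE : (E : Set (Sym2 V)) = Γ.edgeSet) :
    rename (↑) (Γ.kirchhoffPolynomial k)
      = basisSum (X : _ → MvPolynomial (Sym2 V) k) IsForestSet E := by
  have hfin (T : SimpleGraph V) := (Set.toFinite T.edgeSet).coe_toFinset
  have hmem (S : Finset (Sym2 V)) :
      S ∈ bases IsForestSet E ↔ Maximal (fun S => S ⊆ E ∧ IsForestSet S) S := by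
    rw [bases, Finset.mem_filter, Finset.mem_powerset]
    exact and_iff_right_of_imp fun h => h.1.1
  have hedge {S : Finset (Sym2 V)} (hS : S ∈ bases IsForestSet E) :
      (fromEdgeSet (S : Set (Sym2 V))).edgeSet = S :=
    edgeSet_fromEdgeSet_of_subset (hE.le.trans' (Finset.coe_subset.mpr ((hmem S).mp hS).1.1))
  rw [kirchhoffPolynomial, map_sum, basisSum]
  refine Finset.sum_bij' (fun T _ => (Set.toFinite T.edgeSet).toFinset)
    (fun S _ => fromEdgeSet (S : Set (Sym2 V))) ?_ ?_ ?_ ?_ ?_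
  · intro T hT
    rw [Finset.mem_filter] at hT
    exact (hmem _).mpr ((maximal_isForestSet_iff hE (hfin T)).mpr hT.2)
  · intro S hS
    rw [Finset.mem_filter]
    refine ⟨Finset.mem_univ _, ?_⟩
    rw [← maximal_isForestSet_iff hE (hedge hS).symm, ← hmem]
    exact hS
  · intro T _
    rw [hfin, fromEdgeSet_edgeSet]
  · intro S hS
    rw [← Finset.coe_inj, hfin, hedge hS]
  · intro T _
    rw [map_prod]
    refine Finset.prod_bij (fun e _ => (e : Sym2 V)) ?_ ?_ ?_ ?_
    · intro e he
      have : (e : Sym2 V) ∈ (E : Set (Sym2 V)) := hE.ge e.2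
      rw [Finset.mem_sdiff, Set.Finite.mem_toFinset]
      exact ⟨this, (Finset.mem_filter.mp he).2⟩
    · exact fun _ _ _ _ h => Subtype.ext h
    · intro e he
      rw [Finset.mem_sdiff, Set.Finite.mem_toFinset] at he
      have : e ∈ Γ.edgeSet := hE ▸ Finset.mem_coe.mpr he.1
      exact ⟨⟨e, this⟩, Finset.mem_filter.mpr ⟨Finset.mem_univ _, he.2⟩, rfl⟩
    · exact fun e _ => rename_X _ e

theorem cls_graphHypersurface_mem {F : Set (Sym2 V)} (h : PolygonChain Γ.edgeSet F) :
    cls (Γ.graphHypersurface k) ∈ tateSubring k := by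
  classical
  obtain ⟨E, F, P, hE, -, hT⟩ := h.exists_isTame (k := k)
  have hf := rename_kirchhoffPolynomial (k := k) hE
  obtain ⟨d, hd, hhom, -⟩ := hT.isHomogeneous
  rw [← hf, IsHomogeneous.rename_isHomogeneous_iff Subtype.val_injective] at hhom
  let Q : Finset Γ.edgeSet := Finset.univ.filter fun e => (e : Sym2 V) ∈ P
  refine ProjectiveHypersurface.cls_hypersurfaceVar_mem hd hhom (P := Q) ?_ fun Z hZ i hi hiZ => ?_
  -- Setting the variables of non-edges to `0` undoes the renaming and carries the ideal membership
  -- back to the edge variables.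
  · have hmem := Ideal.mem_map_of_mem (killCompl (Subtype.val_injective :
      Function.Injective ((↑) : Γ.edgeSet → Sym2 V))) hT.basisSum_mem_span
    rw [← hf, killCompl_rename_app, Ideal.map_span] at hmem
    refine Ideal.span_mono ?_ hmem
    rintro _ ⟨_, ⟨e, he, rfl⟩, rfl⟩
    have heΓ : e ∈ Γ.edgeSet := hE ▸ Finset.coe_subset.mpr hT.first_subset he
    refine ⟨⟨e, heΓ⟩, by simpa [Q] using he, ?_⟩
    have : (X e : MvPolynomial (Sym2 V) k)
        = rename ((↑) : Γ.edgeSet → Sym2 V) (X ⟨e, heΓ⟩) :=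
      (rename_X (R := k) ((↑) : Γ.edgeSet → Sym2 V) ⟨e, heΓ⟩).symm
    rw [this]
    exact (killCompl_rename_app _ _).symm
  · rw [← zeroClass_insert_rename, hf]
    have hZP : Z.image (↑) ⊆ P := by
      intro e he
      obtain ⟨e, heZ, rfl⟩ := Finset.mem_image.mp he
      exact (Finset.mem_filter.mp (hZ heZ)).2
    have := hT.zeroClass_mem (Z.image (↑)) hZP i (Finset.mem_filter.mp hi).2 (by
      simpa using hiZ)
    rwa [Finset.coe_image, hE] at this

end SimpleGraph

end

theorem corollary5p11 {k : Type u} [Field k] {V : Type u} [Fintype V] (Γ : SimpleGraph V)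
    (hΓ : Γ.IsPolygonChain) :
    GrothendieckRing.cls (Γ.graphHypersurface k) ∈ GrothendieckRing.tateSubring k := by
  classical
  obtain ⟨⟨F, hF⟩, -⟩ := hΓ
  exact SimpleGraph.cls_graphHypersurface_mem hF
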